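/- Let $\kappa\in\{0,1,-1\}$ and $\alpha\in\mathbb R$. Let $M_\kappa$ be the three dimensional space form of curvature $\kappa$ ($\mathbb R^3$, $S^3$ or hyperbolic space $H^3$), oriented in the standard way, and let $\mathcal G_\kappa$ be the four dimensional manifold of complete oriented geodesics of $M_\kappa$, that is, of unit speed geodesics $\sigma:\mathbb R\to M_\kappa$ up to translations of the parameter, with the differentiable structure of a homogeneous space of the isometry group of $M_\kappa$. Given $\ell\in\mathcal G_\kappa$, $p\in\ell$ and a unit vector $A\in T_pM_\kappa$ orthogonal to $\ell$, let $\sigma$ be the parametrization of $\ell$ with $\sigma(0)=p$, let $\gamma_A$ be the geodesic with initial velocity $A$, and let $V_t$, $B_t$ be the parallel vector fields along $\gamma_A$ with $V_0=\sigma'(0)$ and $B_0=A\times\sigma'(0)$. The $\alpha$-helicoidal curve with initial ray $\ell$ and axis $\gamma_A$ is the curve $\Gamma^\alpha_{\ell,p,A}:\mathbb R\to\mathcal G_\kappa$ for which $\Gamma^\alpha_{\ell,p,A}(t)$ is the oriented geodesic with initial velocity $\cos(\alpha t)V_t+\sin(\alpha t)B_t$ at $\gamma_A(t)$. Let $\mathcal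 A^\alpha_\kappa\subset T\mathcal G_\kappa$ be the set of the initial velocities $(\Gamma^\alpha_{\ell,p,A})'(0)$ of all $\alpha$-helicoidal curves, with the subspace topology and the canonical projection onto $\mathcal G_\kappa$. If $\alpha^2\neq\kappa$, then the bundle $\mathcal A^\alpha_\kappa\to\mathcal G_\kappa$ is not topologically trivial. Moreover, $\mathcal A^\alpha_\kappa$ is not even homeomorphic to the product $\mathcal G_\kappa\times\mathcal F$, where $\mathcal F$ is the fiber of $\mathcal A^\alpha_\kappa\to\mathcal G_\kappa$ over any $\ell\in\mathcal G_\kappa$. -/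

import Mathlib

open Set Filter Topology
open scoped Manifold ContDiff

namespace Helicoid

/-! ### The space forms

The sign `κ : SignType` ranges over `-1, 0, 1`.  All three space forms lie in `ℝ⁴`, Euclidean space
being the affine hyperplane `x₀ = 1`. -/

/-- The bilinear form `⟨x, y⟩_κ = κ x₀ y₀ + x₁ y₁ + x₂ y₂ + x₃ y₃`. -/
def form (κ : SignType) (x y : Fin 4 → ℝ) : ℝ :=
  (κ : ℝ) * (x 0 * y 0) + (x 1 * y 1 + x 2 * y 2 + x 3 * y 3)

/-- The form `x₀ y₀ + κ (x₁ y₁ + x₂ y₂ + x₃ y₃)`.  It equals `κ ⟨x, y⟩_κ` for `κ = ± 1`, and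
`x₀ y₀` for `κ = 0`. -/
def dualForm (κ : SignType) (x y : Fin 4 → ℝ) : ℝ :=
  x 0 * y 0 + (κ : ℝ) * (x 1 * y 1 + x 2 * y 2 + x 3 * y 3)

/-- The space form `M_κ`: the unit sphere `S³` for `κ = 1`, the affine hyperplane `x₀ = 1` for
`κ = 0`, and the sheet `⟨x, x⟩_{-1} = -1`, `x₀ > 0` of the hyperboloid for `κ = -1`. -/
def spaceForm (κ : SignType) : Set (Fin 4 → ℝ) :=
  {x | dualForm κ x x = 1 ∧ (κ ≠ 1 → 0 < x 0)}

/-- The tangent space `T_p M_κ ⊆ ℝ⁴`: the kernel of the differential at `p` of the equation that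
defines `M_κ`. The Riemannian metric of `M_κ` is the restriction of `⟨ , ⟩_κ` to it. -/
def tangentPlane (κ : SignType) (p : Fin 4 → ℝ) : Set (Fin 4 → ℝ) :=
  {w | dualForm κ p w = 0}

/-- The vector field `V` along the curve `c` in `M_κ` is smooth, tangent to `M_κ`, and parallel: its
covariant derivative, which is the tangential part of the derivative in `ℝ⁴`, vanishes. -/
structure IsParallelAlong (κ : SignType) (c V : ℝ → Fin 4 → ℝ) : Prop where
  smooth : ContDiff ℝ ∞ V
  tangent : ∀ t, V t ∈ tangentPlane κ (c t)
  parallel : ∀ t, ∀ w ∈ tangentPlane κ (c t), form κ (deriv V t) w = 0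

/-- Complete unit speed geodesics `ℝ → M_κ`: smooth unit speed curves whose velocity is parallel. -/
structure UnitGeodesic (κ : SignType) where
  /-- the parametrization -/
  curve : ℝ → Fin 4 → ℝ
  smooth : ContDiff ℝ ∞ curve
  mem : ∀ t, curve t ∈ spaceForm κ
  unit_speed : ∀ t, form κ (deriv curve t) (deriv curve t) = 1
  geodesic : IsParallelAlong κ curve (deriv curve)

/-- `w = u × v` in `T_p M_κ`, for orthonormal `u, v ∈ T_p M_κ`: the unit tangent vector `w`
orthogonal to `u` and `v` for which `(p, u, v, w)` is a positive basis of `ℝ⁴`. -/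
def IsCross (κ : SignType) (p u v w : Fin 4 → ℝ) : Prop :=
  w ∈ tangentPlane κ p ∧ form κ w w = 1 ∧ form κ u w = 0 ∧ form κ v w = 0 ∧
    0 < (Matrix.of ![p, u, v, w]).det

/-! ### The set of oriented geodesics -/

/-- Two unit speed geodesics are equivalent if they differ by a translation of the parameter. -/
instance geodesicSetoid (κ : SignType) : Setoid (UnitGeodesic κ) where
  r σ τ := ∃ t₀ : ℝ, ∀ t, σ.curve t = τ.curve (t + t₀)
  iseqv :=
    { refl := fun σ => ⟨0, fun t => by simp⟩
      symm := by
        rintro σ τ ⟨t₀, h⟩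
        exact ⟨-t₀, fun t => by rw [h]; simp⟩
      trans := by
        rintro σ τ υ ⟨t₀, h⟩ ⟨t₁, h'⟩
        exact ⟨t₀ + t₁, fun t => by rw [h, h', add_assoc]⟩ }

/-- The set `𝒢_κ` of oriented complete geodesics of `M_κ`. -/
def OrientedGeodesic (κ : SignType) : Type := Quotient (geodesicSetoid κ)

/-! ### Explicit form of the geodesics -/

/-- `cos`, the constant `1`, or `cosh`. -/
noncomputable def cosK (κ : SignType) (t : ℝ) : ℝ :=
  if κ = 1 then Real.cos t else if κ = 0 then 1 else Real.cosh t

/-- `sin`, the identity, or `sinh`. -/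
noncomputable def sinK (κ : SignType) (t : ℝ) : ℝ :=
  if κ = 1 then Real.sin t else if κ = 0 then t else Real.sinh t

lemma hasDerivAt_cosK (κ : SignType) (t : ℝ) : HasDerivAt (cosK κ) (-(κ : ℝ) * sinK κ t) t := by
  rcases κ.trichotomy with rfl | rfl | rfl
  · have : cosK (-1) = Real.cosh := by ext s; simp [cosK]
    rw [this]; simpa [sinK] using Real.hasDerivAt_cosh t
  · have : cosK 0 = fun _ => 1 := by ext s; simp [cosK]
    rw [this]; simpa using hasDerivAt_const t (1 : ℝ)
  · have : cosK 1 = Real.cos := by ext s; simp [cosK]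
    rw [this]; simpa [sinK] using Real.hasDerivAt_cos t

lemma hasDerivAt_sinK (κ : SignType) (t : ℝ) : HasDerivAt (sinK κ) (cosK κ t) t := by
  rcases κ.trichotomy with rfl | rfl | rfl
  · have : sinK (-1) = Real.sinh := by ext s; simp [sinK]
    rw [this]; simpa [cosK] using Real.hasDerivAt_sinh t
  · have : sinK 0 = fun s => s := by ext s; simp [sinK]
    rw [this]; simpa [cosK] using hasDerivAt_id' t
  · have : sinK 1 = Real.sin := by ext s; simp [sinK]
    rw [this]; simpa [cosK] using Real.hasDerivAt_sin t

lemma contDiff_cosK (κ : SignType) : ContDiff ℝ ∞ (cosK κ) := by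
  rcases κ.trichotomy with rfl | rfl | rfl
  · have : cosK (-1) = Real.cosh := by ext s; simp [cosK]
    rw [this]; exact Real.contDiff_cosh
  · have : cosK 0 = fun _ => 1 := by ext s; simp [cosK]
    rw [this]; exact contDiff_const
  · have : cosK 1 = Real.cos := by ext s; simp [cosK]
    rw [this]; exact Real.contDiff_cos

lemma contDiff_sinK (κ : SignType) : ContDiff ℝ ∞ (sinK κ) := by
  rcases κ.trichotomy with rfl | rfl | rfl
  · have : sinK (-1) = Real.sinh := by ext s; simp [sinK]
    rw [this]; exact Real.contDiff_sinh
  · have : sinK 0 = fun s => s := by ext s; simp [sinK]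
    rw [this]; exact contDiff_id
  · have : sinK 1 = Real.sin := by ext s; simp [sinK]
    rw [this]; exact Real.contDiff_sin

lemma cosK_sq_add (κ : SignType) (t : ℝ) : cosK κ t ^ 2 + (κ : ℝ) * sinK κ t ^ 2 = 1 := by
  rcases κ.trichotomy with rfl | rfl | rfl
  · simp [cosK, sinK, Real.cosh_sq]
  · simp [cosK]
  · simp [cosK, sinK]

lemma cosK_add (κ : SignType) (s t : ℝ) :
    cosK κ (s + t) = cosK κ s * cosK κ t - (κ : ℝ) * (sinK κ s * sinK κ t) := by
  rcases κ.trichotomy with rfl | rfl | rfl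
  · simp [cosK, sinK, Real.cosh_add]
  · simp [cosK]
  · simp [cosK, sinK, Real.cos_add]

lemma sinK_add (κ : SignType) (s t : ℝ) :
    sinK κ (s + t) = sinK κ s * cosK κ t + cosK κ s * sinK κ t := by
  rcases κ.trichotomy with rfl | rfl | rfl
  · simp [cosK, sinK, Real.sinh_add]
  · simp [cosK, sinK]
  · simp [cosK, sinK, Real.sin_add]

lemma cosK_zero (κ : SignType) : cosK κ 0 = 1 := by
  simp [cosK]

lemma sinK_zero (κ : SignType) : sinK κ 0 = 0 := by
  simp [sinK]

lemma exists_cosK_sinK (κ : SignType) {a b : ℝ} (h : a ^ 2 + (κ : ℝ) * b ^ 2 = 1)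
    (ha : κ ≠ 1 → 0 < a) : ∃ t, cosK κ t = a ∧ sinK κ t = b := by
  rcases κ.trichotomy with rfl | rfl | rfl
  · refine ⟨Real.arsinh b, ?_, by simp [sinK]⟩
    have h1 : a ^ 2 = 1 + b ^ 2 := by simp at h; linarith
    have h2 : (0 : ℝ) < a := ha (by decide)
    simp only [cosK]
    rw [if_neg (by decide), if_neg (by decide), Real.cosh_arsinh, ← h1, Real.sqrt_sq h2.le]
  · refine ⟨b, ?_, by simp [sinK]⟩
    have h1 : a ^ 2 = 1 := by simpa using h
    have h2 : (0 : ℝ) < a := ha (by decide)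
    simp only [cosK]
    rw [if_neg (by decide)]
    simp
    nlinarith
  · have h1 : a ^ 2 + b ^ 2 = 1 := by simpa using h
    refine ⟨Complex.arg ⟨a, b⟩, ?_, ?_⟩
    · have hn : ‖(⟨a, b⟩ : ℂ)‖ = 1 := by
        rw [Complex.norm_def, Complex.normSq_mk, ← sq, ← sq, h1, Real.sqrt_one]
      have h0 : (⟨a, b⟩ : ℂ) ≠ 0 := by
        intro h; rw [h] at hn; simp at hn
      simp [cosK, Complex.cos_arg h0, hn]
    · have hn : ‖(⟨a, b⟩ : ℂ)‖ = 1 := by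
        rw [Complex.norm_def, Complex.normSq_mk, ← sq, ← sq, h1, Real.sqrt_one]
      simp [sinK, Complex.sin_arg, hn]

lemma sign_cube (κ : SignType) : (κ : ℝ) * κ * κ = κ := by
  rcases κ.trichotomy with rfl | rfl | rfl <;> simp

/-- The form `⟨ , ⟩_κ` is positive definite on the tangent spaces. -/
lemma eq_zero_of_form_self {κ : SignType} {p z : Fin 4 → ℝ} (hp : p ∈ spaceForm κ)
    (hz : z ∈ tangentPlane κ p) (h : form κ z z = 0) : z = 0 := by
  obtain ⟨h1, h2⟩ := hp
  simp only [tangentPlane, mem_ofPred_eq, dualForm, form] at *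
  have key : z 0 = 0 ∧ z 1 ^ 2 + z 2 ^ 2 + z 3 ^ 2 = 0 := by
    rcases κ.trichotomy with rfl | rfl | rfl
    · simp at h h1 hz
      have e1 : (z 0) ^ 2 = z 1 ^ 2 + z 2 ^ 2 + z 3 ^ 2 := by nlinarith
      have e2 : p 0 ^ 2 = 1 + (p 1 ^ 2 + p 2 ^ 2 + p 3 ^ 2) := by nlinarith
      have e3 : p 0 * z 0 = p 1 * z 1 + p 2 * z 2 + p 3 * z 3 := by linarith
      have e4 : (p 0 * z 0) ^ 2
          ≤ (p 1 ^ 2 + p 2 ^ 2 + p 3 ^ 2) * (z 1 ^ 2 + z 2 ^ 2 + z 3 ^ 2) := by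
        rw [e3]
        nlinarith [sq_nonneg (p 1 * z 2 - p 2 * z 1), sq_nonneg (p 1 * z 3 - p 3 * z 1),
          sq_nonneg (p 2 * z 3 - p 3 * z 2)]
      rw [mul_pow, e2, ← e1] at e4
      have e5 : z 0 ^ 2 = 0 := le_antisymm (by nlinarith) (sq_nonneg _)
      exact ⟨by simpa using e5, by rw [← e1, e5]⟩
    · simp at h h1 hz
      have hp0 : p 0 ≠ 0 := (h2 (by decide)).ne'
      rcases hz with hz | hz
      · exact absurd hz hp0
      · exact ⟨hz, by nlinarith⟩
    · simp at h
      have e0 : z 0 ^ 2 = 0 := le_antisymm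
        (by nlinarith [sq_nonneg (z 1), sq_nonneg (z 2), sq_nonneg (z 3)]) (sq_nonneg _)
      have e1 : z 0 = 0 := by simpa using e0
      rw [e1] at h
      exact ⟨e1, by nlinarith⟩
  obtain ⟨k0, k⟩ := key
  have k1 : z 1 = 0 := by nlinarith [sq_nonneg (z 1), sq_nonneg (z 2), sq_nonneg (z 3)]
  have k2 : z 2 = 0 := by nlinarith [sq_nonneg (z 1), sq_nonneg (z 2), sq_nonneg (z 3)]
  have k3 : z 3 = 0 := by nlinarith [sq_nonneg (z 1), sq_nonneg (z 2), sq_nonneg (z 3)]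
  ext i; fin_cases i <;> simp [k0, k1, k2, k3]

lemma hasDerivAt_dualForm (κ : SignType) {x y : ℝ → Fin 4 → ℝ} {x' y' : Fin 4 → ℝ} {t : ℝ}
    (hx : HasDerivAt x x' t) (hy : HasDerivAt y y' t) :
    HasDerivAt (fun s => dualForm κ (x s) (y s)) (dualForm κ x' (y t) + dualForm κ (x t) y') t := by
  have hx := hasDerivAt_pi.1 hx
  have hy := hasDerivAt_pi.1 hy
  have := ((hx 0).mul (hy 0)).add
    (((((hx 1).mul (hy 1)).add ((hx 2).mul (hy 2))).add ((hx 3).mul (hy 3))).const_mul (κ : ℝ))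
  refine this.congr_deriv ?_
  simp only [dualForm]; ring

namespace UnitGeodesic

variable {κ : SignType} (σ : UnitGeodesic κ)

lemma hasDerivAt (t : ℝ) : HasDerivAt σ.curve (deriv σ.curve t) t :=
  (σ.smooth.differentiable (by simp)).differentiableAt.hasDerivAt

lemma hasDerivAt_deriv (t : ℝ) :
    HasDerivAt (deriv σ.curve) (deriv (deriv σ.curve) t) t :=
  (σ.geodesic.smooth.differentiable (by simp)).differentiableAt.hasDerivAt

lemma dualForm_velocity (t : ℝ) :
    dualForm κ (deriv σ.curve t) (deriv σ.curve t) = κ := by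
  have h := σ.unit_speed t
  have h0 := σ.geodesic.tangent t
  have h1 := (σ.mem t).1
  have h2 := (σ.mem t).2
  simp only [tangentPlane, mem_ofPred_eq, dualForm, form] at *
  rcases κ.trichotomy with rfl | rfl | rfl
  · simp at *; linarith
  · simp at *
    rcases h0 with h0 | h0
    · exact absurd h0 h2.ne'
    · exact h0
  · simp at *; linarith

/-- The geodesic equation in `ℝ⁴`. -/
lemma deriv_deriv (t : ℝ) : deriv (deriv σ.curve) t = -(κ : ℝ) • σ.curve t := by
  set z : Fin 4 → ℝ := deriv (deriv σ.curve) t + (κ : ℝ) • σ.curve t with hz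
  have hd := hasDerivAt_dualForm κ (σ.hasDerivAt t) (σ.hasDerivAt_deriv t)
  have h0 : (fun s => dualForm κ (σ.curve s) (deriv σ.curve s)) = fun _ => 0 :=
    funext fun s => σ.geodesic.tangent s
  rw [h0] at hd
  have e1 := hd.unique (hasDerivAt_const t (0 : ℝ))
  rw [σ.dualForm_velocity] at e1
  have e2 := (σ.mem t).1
  have hzt : z ∈ tangentPlane κ (σ.curve t) := by
    simp only [tangentPlane, mem_ofPred_eq, hz]
    simp only [dualForm, Pi.add_apply, Pi.smul_apply, smul_eq_mul] at *
    linear_combination e1 + (κ : ℝ) * e2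
  have e3 := σ.geodesic.parallel t z hzt
  have e4 : form κ z z = 0 := by
    have e5 : dualForm κ (σ.curve t) z = 0 := hzt
    have e6 : form κ z z = form κ (deriv (deriv σ.curve) t) z + κ * form κ (σ.curve t) z := by
      simp only [hz, form, Pi.add_apply, Pi.smul_apply, smul_eq_mul]; ring
    rw [e6, e3, zero_add]
    have e7 := sign_cube κ
    rcases κ.trichotomy with rfl | rfl | rfl
    · simp [dualForm, form] at *; linarith
    · simp
    · simp [dualForm, form] at *; linarith
  have := eq_zero_of_form_self (σ.mem t) hzt e4
  rw [neg_smul]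
  exact eq_neg_of_add_eq_zero_left this

/-- `σ(t) = cos_κ t σ(0) + sin_κ t σ'(0)`, together with the derivative of this equation. -/
lemma formula (t : ℝ) :
    σ.curve t = cosK κ t • σ.curve 0 + sinK κ t • deriv σ.curve 0 ∧
    deriv σ.curve t = (-(κ : ℝ) * sinK κ t) • σ.curve 0 + cosK κ t • deriv σ.curve 0 := by
  have h1 : ∀ s, HasDerivAt (fun s => cosK κ s • σ.curve s - sinK κ s • deriv σ.curve s) 0 s := by
    intro s
    have := ((hasDerivAt_cosK κ s).smul (σ.hasDerivAt s)).sub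
      ((hasDerivAt_sinK κ s).smul (σ.hasDerivAt_deriv s))
    refine this.congr_deriv ?_
    rw [σ.deriv_deriv]; module
  have h2 : ∀ s, HasDerivAt
      (fun s => ((κ : ℝ) * sinK κ s) • σ.curve s + cosK κ s • deriv σ.curve s) 0 s := by
    intro s
    have := (((hasDerivAt_sinK κ s).const_mul (κ : ℝ)).smul (σ.hasDerivAt s)).add
      ((hasDerivAt_cosK κ s).smul (σ.hasDerivAt_deriv s))
    refine this.congr_deriv ?_
    rw [σ.deriv_deriv]; module
  have c1 := is_const_of_deriv_eq_zero (fun s => (h1 s).differentiableAt) (fun s => (h1 s).deriv) t 0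
  have c2 := is_const_of_deriv_eq_zero (fun s => (h2 s).differentiableAt) (fun s => (h2 s).deriv) t 0
  simp only [cosK_zero, sinK_zero, one_smul, zero_smul, sub_zero, mul_zero, zero_add] at c1 c2
  have h := cosK_sq_add κ t
  constructor
  · rw [← c1, ← c2]
    have : σ.curve t = (cosK κ t ^ 2 + (κ : ℝ) * sinK κ t ^ 2) • σ.curve t := by rw [h, one_smul]
    nth_rewrite 1 [this]
    module
  · rw [← c1, ← c2]
    have : deriv σ.curve t = (cosK κ t ^ 2 + (κ : ℝ) * sinK κ t ^ 2) • deriv σ.curve t := by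
      rw [h, one_smul]
    nth_rewrite 1 [this]
    module

end UnitGeodesic

lemma combination_mem {κ : SignType} {p u : Fin 4 → ℝ} (hp : p ∈ spaceForm κ)
    (hu : u ∈ tangentPlane κ p) (h : form κ u u = 1) {a b : ℝ}
    (hab : a ^ 2 + (κ : ℝ) * b ^ 2 = 1) (ha : κ ≠ 1 → 0 < a) : a • p + b • u ∈ spaceForm κ := by
  obtain ⟨h1, h2⟩ := hp
  simp only [spaceForm, tangentPlane, mem_ofPred_eq, dualForm, form, Pi.add_apply, Pi.smul_apply,
    smul_eq_mul] at *
  rcases κ.trichotomy with rfl | rfl | rfl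
  · have h2 := h2 (by decide)
    have ha := ha (by decide)
    simp at *
    refine ⟨by linear_combination a ^ 2 * h1 + 2 * a * b * hu - b ^ 2 * h + hab, ?_⟩
    have e3 : p 0 * u 0 = p 1 * u 1 + p 2 * u 2 + p 3 * u 3 := by linarith
    have e4 : (p 0 * u 0) ^ 2
        ≤ (p 1 ^ 2 + p 2 ^ 2 + p 3 ^ 2) * (u 1 ^ 2 + u 2 ^ 2 + u 3 ^ 2) := by
      rw [e3]
      nlinarith [sq_nonneg (p 1 * u 2 - p 2 * u 1), sq_nonneg (p 1 * u 3 - p 3 * u 1),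
        sq_nonneg (p 2 * u 3 - p 3 * u 2)]
    have e5 : p 1 ^ 2 + p 2 ^ 2 + p 3 ^ 2 = p 0 ^ 2 - 1 := by nlinarith
    have e6 : u 1 ^ 2 + u 2 ^ 2 + u 3 ^ 2 = u 0 ^ 2 + 1 := by nlinarith
    rw [e5, e6] at e4
    have e7 : u 0 ^ 2 < p 0 ^ 2 := by nlinarith
    have e8 : |u 0| < p 0 := abs_lt_of_sq_lt_sq e7 h2.le
    have e9 : |b| < a := abs_lt_of_sq_lt_sq (by linarith) ha.le
    have e10 : |b * u 0| < a * p 0 := by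
      rw [abs_mul]; exact mul_lt_mul'' e9 e8 (abs_nonneg _) (abs_nonneg _)
    linarith [(abs_lt.1 e10).1]
  · have h2 := h2 (by decide)
    have ha := ha (by decide)
    simp at *
    have hu0 : u 0 = 0 := hu.resolve_left h2.ne'
    refine ⟨?_, by rw [hu0]; simp; positivity⟩
    rw [hu0]
    have : a = 1 := hab.resolve_right (by linarith)
    simp [this, h1]
  · simp at *
    linear_combination a ^ 2 * h1 + 2 * a * b * hu + b ^ 2 * h + hab

lemma cosK_pos {κ : SignType} (h : κ ≠ 1) (t : ℝ) : 0 < cosK κ t := by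
  rcases κ.trichotomy with rfl | rfl | rfl
  · simp [cosK, Real.cosh_pos]
  · simp [cosK]
  · exact absurd rfl h

/-- The geodesic with initial point `p` and initial unit velocity `u`. -/
noncomputable def geodesicOf {κ : SignType} {p u : Fin 4 → ℝ} (hp : p ∈ spaceForm κ)
    (hu : u ∈ tangentPlane κ p) (h : form κ u u = 1) : UnitGeodesic κ :=
  have hd : ∀ t, HasDerivAt (fun t => cosK κ t • p + sinK κ t • u)
      ((-(κ : ℝ) * sinK κ t) • p + cosK κ t • u) t := fun t =>
    ((hasDerivAt_cosK κ t).smul_const p).add ((hasDerivAt_sinK κ t).smul_const u)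
  have hd' : deriv (fun t => cosK κ t • p + sinK κ t • u)
      = fun t => (-(κ : ℝ) * sinK κ t) • p + cosK κ t • u := funext fun t => (hd t).deriv
  have hdd : ∀ t, HasDerivAt (fun t => (-(κ : ℝ) * sinK κ t) • p + cosK κ t • u)
      ((-(κ : ℝ) * cosK κ t) • p + (-(κ : ℝ) * sinK κ t) • u) t := fun t =>
    (((hasDerivAt_sinK κ t).const_mul (-(κ : ℝ))).smul_const p).add
      ((hasDerivAt_cosK κ t).smul_const u)
  { curve := fun t => cosK κ t • p + sinK κ t • u
    smooth := ((contDiff_cosK κ).smul contDiff_const).add ((contDiff_sinK κ).smul contDiff_const)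
    mem := fun t => combination_mem hp hu h (cosK_sq_add κ t) (fun h => cosK_pos h t)
    unit_speed := by
      intro t
      rw [hd']
      have h1 := hp.1
      have hc := cosK_sq_add κ t
      simp only [tangentPlane, mem_ofPred_eq, dualForm, form, Pi.add_apply, Pi.smul_apply,
        smul_eq_mul] at *
      generalize cosK κ t = c at *
      generalize sinK κ t = s at *
      clear hd hd' hdd
      rcases κ.trichotomy with rfl | rfl | rfl
      · simp at *
        linear_combination (-s ^ 2) * h1 - 2 * s * c * hu + c ^ 2 * h + hc
      · simp at *
        rcases hc with rfl | rfl <;> linarith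
      · simp at *
        linear_combination (s ^ 2) * h1 - 2 * s * c * hu + c ^ 2 * h + hc
    geodesic :=
      { smooth := by
          rw [hd']
          exact ((contDiff_const.mul (contDiff_sinK κ)).smul contDiff_const).add
            ((contDiff_cosK κ).smul contDiff_const)
        tangent := by
          intro t
          rw [hd']
          have h1 := hp.1
          simp only [tangentPlane, mem_ofPred_eq, dualForm, form, Pi.add_apply, Pi.smul_apply,
            smul_eq_mul] at *
          have h3 : u 0 ^ 2 + κ * (u 1 ^ 2 + u 2 ^ 2 + u 3 ^ 2) = κ := by
            have h2 := hp.2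
            rcases κ.trichotomy with rfl | rfl | rfl
            · simp at *; linarith
            · have h2 := h2 (by decide)
              simp at *
              exact hu.resolve_left h2.ne'
            · simp at *; linarith
          linear_combination (-(κ : ℝ) * sinK κ t * cosK κ t) * h1 + (cosK κ t ^ 2
            - (κ : ℝ) * sinK κ t ^ 2) * hu + (sinK κ t * cosK κ t) * h3
        parallel := by
          intro t w hw
          rw [hd', (hdd t).deriv]
          simp only [tangentPlane, mem_ofPred_eq, dualForm, form, Pi.add_apply, Pi.smul_apply,
            smul_eq_mul] at *
          clear hd hd' hdd
          rcases κ.trichotomy with rfl | rfl | rfl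
          · simp at *; linarith
          · simp
          · simp at *; linarith } }

lemma geodesicOf_zero {κ : SignType} {p u : Fin 4 → ℝ} (hp : p ∈ spaceForm κ)
    (hu : u ∈ tangentPlane κ p) (h : form κ u u = 1) :
    (geodesicOf hp hu h).curve 0 = p ∧ deriv (geodesicOf hp hu h).curve 0 = u := by
  have hd : HasDerivAt (geodesicOf hp hu h).curve
      ((-(κ : ℝ) * sinK κ 0) • p + cosK κ 0 • u) 0 :=
    ((hasDerivAt_cosK κ 0).smul_const p).add ((hasDerivAt_sinK κ 0).smul_const u)
  refine ⟨?_, ?_⟩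
  · simp [geodesicOf, cosK_zero, sinK_zero]
  · rw [hd.deriv]; simp [cosK_zero, sinK_zero]

/-! ### Plücker coordinates

An oriented geodesic `[σ]` is determined by the bivector `σ ∧ σ' ∈ Λ²ℝ⁴`, which does not depend on
the point of `σ` where it is evaluated.  As `[σ] ↦ σ ∧ σ'` intertwines the action of the isometries of
`M_κ` on `𝒢_κ` and their linear action on `Λ²ℝ⁴`, it is an embedding of the homogeneous
space `𝒢_κ`; its image is a closed submanifold given by two equations.  The topology and the
smooth structure of `𝒢_κ` are those of this submanifold.  (For `κ = 0` the coordinates are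
the direction `v` and the moment `u × v` of the oriented line `s ↦ u + s v`.) -/

/-- The coordinates of `x ∧ y`, in the order `01, 02, 03, 23, 31, 12`. -/
def wedge (x y : Fin 4 → ℝ) : Fin 6 → ℝ :=
  ![x 0 * y 1 - x 1 * y 0, x 0 * y 2 - x 2 * y 0, x 0 * y 3 - x 3 * y 0,
    x 2 * y 3 - x 3 * y 2, x 3 * y 1 - x 1 * y 3, x 1 * y 2 - x 2 * y 1]

lemma wedge_combination (x y : Fin 4 → ℝ) (a b c d : ℝ) :
    wedge (a • x + b • y) (c • x + d • y) = (a * d - b * c) • wedge x y := by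
  ext i
  fin_cases i <;> simp [wedge] <;> ring

/-- The square norm on bivectors that `⟨ , ⟩_κ` induces, up to the factor `κ` if `κ = ± 1`. -/
def pluckerNorm (κ : SignType) (w : Fin 6 → ℝ) : ℝ :=
  w 0 ^ 2 + w 1 ^ 2 + w 2 ^ 2 + (κ : ℝ) * (w 3 ^ 2 + w 4 ^ 2 + w 5 ^ 2)

/-- The image of `𝒢_κ`: decomposable bivectors of norm one. -/
def quadric (κ : SignType) : Set (Fin 6 → ℝ) :=
  {w | w 0 * w 3 + w 1 * w 4 + w 2 * w 5 = 0 ∧ pluckerNorm κ w = 1}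

lemma UnitGeodesic.wedge_eq {κ : SignType} (σ : UnitGeodesic κ) (t : ℝ) :
    wedge (σ.curve t) (deriv σ.curve t) = wedge (σ.curve 0) (deriv σ.curve 0) := by
  rw [(σ.formula t).1, (σ.formula t).2, wedge_combination]
  have h := cosK_sq_add κ t
  rw [show cosK κ t * cosK κ t - sinK κ t * (-(κ : ℝ) * sinK κ t) = 1 by linarith, one_smul]

lemma wedge_mem_quadric {κ : SignType} {p u : Fin 4 → ℝ} (hp : p ∈ spaceForm κ)
    (hu : u ∈ tangentPlane κ p) (h : form κ u u = 1) : wedge p u ∈ quadric κ := by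
  obtain ⟨h1, h2⟩ := hp
  refine ⟨by simp [wedge]; ring, ?_⟩
  simp only [tangentPlane, mem_ofPred_eq, dualForm, form, pluckerNorm, wedge] at *
  rcases κ.trichotomy with rfl | rfl | rfl
  · simp at *
    linear_combination (-(u 0 * u 0) + (u 1 * u 1 + u 2 * u 2 + u 3 * u 3)) * h1 + h
      + (p 0 * u 0 - (p 1 * u 1 + p 2 * u 2 + p 3 * u 3)) * hu
  · have h2 := h2 (by decide)
    simp at *
    have hu0 : u 0 = 0 := hu.resolve_left h2.ne'
    rw [hu0]
    have : p 0 = 1 := by nlinarith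
    rw [this]; simp; linarith
  · simp at *
    linear_combination (u 0 * u 0 + (u 1 * u 1 + u 2 * u 2 + u 3 * u 3)) * h1 + h
      - (p 0 * u 0 + (p 1 * u 1 + p 2 * u 2 + p 3 * u 3)) * hu

lemma exists_combination {p u q v : Fin 4 → ℝ} (h : wedge q v = wedge p u) (h0 : wedge p u ≠ 0) :
    ∃ a b : ℝ, q = a • p + b • u := by
  have key : ∀ i j : Fin 4, p i * u j - p j * u i = q i * v j - q j * v i := by
    have e0 := congrFun h 0
    have e1 := congrFun h 1
    have e2 := congrFun h 2
    have e3 := congrFun h 3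
    have e4 := congrFun h 4
    have e5 := congrFun h 5
    simp [wedge] at e0 e1 e2 e3 e4 e5
    intro i j
    fin_cases i <;> fin_cases j <;> simp <;> linarith
  obtain ⟨i, j, hij⟩ : ∃ i j : Fin 4, p i * u j - p j * u i ≠ 0 := by
    by_contra! hc
    apply h0
    ext k
    fin_cases k <;> simp [wedge, hc]
  refine ⟨(q i * u j - q j * u i) / (p i * u j - p j * u i),
    (p i * q j - p j * q i) / (p i * u j - p j * u i), ?_⟩
  ext k
  simp only [Pi.add_apply, Pi.smul_apply, smul_eq_mul]
  rw [div_mul_eq_mul_div, div_mul_eq_mul_div, ← add_div, eq_div_iff hij]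
  linear_combination q i * key j k - q j * key i k + q k * key i j

lemma rel_of_wedge_eq {κ : SignType} (σ τ : UnitGeodesic κ)
    (h : wedge (σ.curve 0) (deriv σ.curve 0) = wedge (τ.curve 0) (deriv τ.curve 0)) :
    ∃ t₀ : ℝ, ∀ t, σ.curve t = τ.curve (t + t₀) := by
  have hq := wedge_mem_quadric (τ.mem 0) (τ.geodesic.tangent 0) (τ.unit_speed 0)
  have h0 : wedge (τ.curve 0) (deriv τ.curve 0) ≠ 0 := by
    intro h0
    rw [h0] at hq
    have := hq.2
    simp [pluckerNorm] at this
  obtain ⟨a, b, hab⟩ := exists_combination h h0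
  have h1 : a ^ 2 + (κ : ℝ) * b ^ 2 = 1 := by
    have e1 := (σ.mem 0).1
    have e2 := (τ.mem 0).1
    have e3 := τ.geodesic.tangent 0
    have e4 := τ.dualForm_velocity 0
    rw [hab] at e1
    simp only [tangentPlane, mem_ofPred_eq, dualForm, Pi.add_apply, Pi.smul_apply,
      smul_eq_mul] at *
    linear_combination e1 - a ^ 2 * e2 - 2 * a * b * e3 - b ^ 2 * e4
  have h2 : κ ≠ 1 → 0 < a := by
    intro hκ
    by_contra! ha
    have ha' : 0 < -a := by
      rcases κ.trichotomy with rfl | rfl | rfl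
      · simp at h1; nlinarith
      · simp at h1; rcases h1 with h1 | h1 <;> linarith
      · exact absurd rfl hκ
    have := (combination_mem (τ.mem 0) (τ.geodesic.tangent 0) (τ.unit_speed 0)
      (a := -a) (b := -b) (by linarith) (fun _ => ha')).2 hκ
    have e := (σ.mem 0).2 hκ
    rw [hab] at e
    simp at this e
    linarith
  obtain ⟨t₀, hc, hs⟩ := exists_cosK_sinK κ h1 h2
  have h3 : σ.curve 0 = τ.curve t₀ := by
    rw [(τ.formula t₀).1, hc, hs, ← hab]
  have h4 : deriv σ.curve 0 = deriv τ.curve t₀ := by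
    have e1 : wedge (τ.curve t₀) (deriv σ.curve 0) = wedge (τ.curve t₀) (deriv τ.curve t₀) := by
      rw [← h3, h, ← τ.wedge_eq t₀, h3]
    have e2 := (τ.mem t₀).1
    have e3 := σ.geodesic.tangent 0
    have e4 := τ.geodesic.tangent t₀
    rw [h3] at e3
    generalize τ.curve t₀ = p at *
    generalize deriv σ.curve 0 = x at *
    generalize deriv τ.curve t₀ = y at *
    have key : ∀ i j : Fin 4, p i * (x j - y j) = p j * (x i - y i) := by
      have f0 := congrFun e1 0
      have f1 := congrFun e1 1
      have f2 := congrFun e1 2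
      have f3 := congrFun e1 3
      have f4 := congrFun e1 4
      have f5 := congrFun e1 5
      simp [wedge] at f0 f1 f2 f3 f4 f5
      intro i j
      fin_cases i <;> fin_cases j <;> simp <;> linarith
    ext k
    simp only [tangentPlane, mem_ofPred_eq, dualForm] at e2 e3 e4
    linear_combination -(x k - y k) * e2 + p k * (e3 - e4) + p 0 * key 0 k
      + κ * (p 1 * key 1 k + p 2 * key 2 k + p 3 * key 3 k)
  refine ⟨t₀, fun t => ?_⟩
  rw [(σ.formula t).1, (τ.formula (t + t₀)).1, h3, h4, (τ.formula t₀).1, (τ.formula t₀).2,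
    cosK_add, sinK_add]
  module

lemma exists_unit_orthogonal (x y z : ℝ) :
    ∃ a b c : ℝ, a ^ 2 + b ^ 2 + c ^ 2 = 1 ∧ a * x + b * y + c * z = 0 := by
  by_cases h : x ^ 2 + y ^ 2 = 0
  · have hx : x = 0 := by nlinarith [sq_nonneg x, sq_nonneg y]
    exact ⟨1, 0, 0, by norm_num, by simp [hx]⟩
  · have hr : 0 < x ^ 2 + y ^ 2 := lt_of_le_of_ne (by positivity) (Ne.symm h)
    have h1 := Real.sq_sqrt hr.le
    have h2 := (Real.sqrt_pos.2 hr).ne'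
    refine ⟨y / √(x ^ 2 + y ^ 2), -x / √(x ^ 2 + y ^ 2), 0, ?_, ?_⟩
    · rw [div_pow, div_pow, h1]; field_simp; ring
    · field_simp; ring

lemma exists_of_mem_quadric {κ : SignType} {w : Fin 6 → ℝ} (hw : w ∈ quadric κ) :
    ∃ p u : Fin 4 → ℝ, p ∈ spaceForm κ ∧ u ∈ tangentPlane κ p ∧ form κ u u = 1 ∧
      wedge p u = w := by
  obtain ⟨h1, h2⟩ := hw
  simp only [pluckerNorm] at h2
  by_cases hv : w 0 = 0 ∧ w 1 = 0 ∧ w 2 = 0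
  · obtain ⟨v0, v1, v2⟩ := hv
    rw [v0, v1, v2] at h2
    obtain rfl : κ = 1 := by
      rcases κ.trichotomy with rfl | rfl | rfl
      · simp at h2; nlinarith [sq_nonneg (w 3), sq_nonneg (w 4), sq_nonneg (w 5)]
      · simp at h2
      · rfl
    simp at h2
    obtain ⟨a, b, c, e1, e2⟩ := exists_unit_orthogonal (w 3) (w 4) (w 5)
    refine ⟨![0, a, b, c], ![0, w 4 * c - w 5 * b, w 5 * a - w 3 * c, w 3 * b - w 4 * a],
      ⟨?_, fun h => absurd rfl h⟩, ?_, ?_, ?_⟩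
    · simp [dualForm]; linarith
    · simp [tangentPlane, dualForm]; ring
    · simp [form]
      linear_combination (w 3 ^ 2 + w 4 ^ 2 + w 5 ^ 2) * e1 + h2
        - (a * w 3 + b * w 4 + c * w 5) * e2
    · ext i
      fin_cases i <;> simp [wedge, v0, v1, v2]
      · linear_combination w 3 * e1 - a * e2
      · linear_combination w 4 * e1 - b * e2
      · linear_combination w 5 * e1 - c * e2
  · have hr : 0 < w 0 ^ 2 + w 1 ^ 2 + w 2 ^ 2 := by
      by_contra! hc
      apply hv
      refine ⟨?_, ?_, ?_⟩ <;> nlinarith [sq_nonneg (w 0), sq_nonneg (w 1), sq_nonneg (w 2)]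
    obtain ⟨r, hr0, hr2⟩ : ∃ r : ℝ, 0 < r ∧ r ^ 2 = w 0 ^ 2 + w 1 ^ 2 + w 2 ^ 2 :=
      ⟨_, Real.sqrt_pos.2 hr, Real.sq_sqrt hr.le⟩
    obtain ⟨a, ha⟩ : ∃ a, w 0 = r * a := ⟨w 0 / r, by field_simp⟩
    obtain ⟨b, hb⟩ : ∃ b, w 1 = r * b := ⟨w 1 / r, by field_simp⟩
    obtain ⟨c, hc⟩ : ∃ c, w 2 = r * c := ⟨w 2 / r, by field_simp⟩
    have e1 : a ^ 2 + b ^ 2 + c ^ 2 = 1 := by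
      rw [ha, hb, hc] at hr2
      have : r ^ 2 * (a ^ 2 + b ^ 2 + c ^ 2) = r ^ 2 * 1 := by linarith
      exact mul_left_cancel₀ (by positivity) this
    have e2 : a * w 3 + b * w 4 + c * w 5 = 0 := by
      rw [ha, hb, hc] at h1
      have : r * (a * w 3 + b * w 4 + c * w 5) = r * 0 := by linarith
      exact mul_left_cancel₀ hr0.ne' this
    refine ⟨![r, b * w 5 - c * w 4, c * w 3 - a * w 5, a * w 4 - b * w 3], ![0, a, b, c],
      ⟨?_, ?_⟩, ?_, ?_, ?_⟩
    · simp [dualForm]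
      linear_combination hr2 + h2 + κ * ((w 3 ^ 2 + w 4 ^ 2 + w 5 ^ 2) * e1
        - (a * w 3 + b * w 4 + c * w 5) * e2)
    · intro _; simpa using hr0
    · simp [tangentPlane, dualForm]; right; ring
    · simp [form]; linarith
    · ext i
      fin_cases i <;> simp [wedge, ha, hb, hc]
      · linear_combination w 3 * e1 - a * e2
      · linear_combination w 4 * e1 - b * e2
      · linear_combination w 5 * e1 - c * e2

namespace OrientedGeodesic

variable {κ : SignType}

/-- The Plücker coordinates of an oriented geodesic. -/
noncomputable def plucker : OrientedGeodesic κ → Fin 6 → ℝ :=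
  Quotient.lift (fun σ : UnitGeodesic κ => wedge (σ.curve 0) (deriv σ.curve 0)) (by
    rintro σ τ ⟨t₀, h⟩
    have h1 : σ.curve = fun t => τ.curve (t + t₀) := funext h
    have h2 : deriv σ.curve 0 = deriv τ.curve t₀ := by
      rw [h1, deriv_comp_add_const]; simp
    show wedge _ _ = wedge _ _
    rw [h2, h 0, zero_add, τ.wedge_eq])

lemma plucker_injective : Function.Injective (plucker (κ := κ)) := by
  intro l m
  refine Quotient.inductionOn₂ l m fun σ τ h => ?_
  exact Quotient.sound (rel_of_wedge_eq σ τ h)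

lemma plucker_mem (l : OrientedGeodesic κ) : plucker l ∈ quadric κ := by
  refine Quotient.inductionOn l fun σ => ?_
  exact wedge_mem_quadric (σ.mem 0) (σ.geodesic.tangent 0) (σ.unit_speed 0)

lemma exists_plucker_eq {w : Fin 6 → ℝ} (hw : w ∈ quadric κ) :
    ∃ l : OrientedGeodesic κ, plucker l = w := by
  obtain ⟨p, u, hp, hu, h, rfl⟩ := exists_of_mem_quadric hw
  refine ⟨Quotient.mk _ (geodesicOf hp hu h), ?_⟩
  show wedge _ _ = _
  rw [(geodesicOf_zero hp hu h).1, (geodesicOf_zero hp hu h).2]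

/-- The geodesic with given Plücker coordinates (a junk value outside the quadric). -/
noncomputable def ofPlucker (κ : SignType) (w : Fin 6 → ℝ) : OrientedGeodesic κ :=
  haveI : Nonempty (OrientedGeodesic κ) :=
    have h : ![1, 0, 0, 0, 0, 0] ∈ quadric κ := ⟨by simp, by simp [pluckerNorm]⟩
    ⟨(exists_plucker_eq h).choose⟩
  Function.invFun plucker w

lemma plucker_ofPlucker {w : Fin 6 → ℝ} (hw : w ∈ quadric κ) :
    plucker (ofPlucker κ w) = w :=
  haveI : Nonempty (OrientedGeodesic κ) := ⟨(exists_plucker_eq hw).choose⟩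
  Function.invFun_eq (exists_plucker_eq hw)

/-! ### The manifold structure

The charts are the affine charts of the Grassmannian of oriented planes: where the Plücker
coordinate with index `i` has the sign `s = ± 1`, the quotients of the others by it, except for the
one with index `i + 3`, are coordinates. -/

noncomputable instance : TopologicalSpace (OrientedGeodesic κ) :=
  TopologicalSpace.induced plucker inferInstance

lemma isInducing_plucker : IsInducing (plucker (κ := κ)) := ⟨rfl⟩

lemma continuous_plucker : Continuous (plucker (κ := κ)) := isInducing_plucker.continuous

end OrientedGeodesic

/-- The four remaining coordinates of an oriented plane. -/
noncomputable def chartFun (i : Fin 6) (s : ℤˣ) (w : Fin 6 → ℝ) : EuclideanSpace ℝ (Fin 4) :=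
  !₂[w (i + 1) / ((s : ℤ) * w i), w (i + 2) / ((s : ℤ) * w i),
    w (i + 4) / ((s : ℤ) * w i), w (i + 5) / ((s : ℤ) * w i)]

/-- The decomposable bivector with given coordinates, normalized by `w i = s`. -/
noncomputable def chartLift (i : Fin 6) (s : ℤˣ) (x : EuclideanSpace ℝ (Fin 4)) : Fin 6 → ℝ :=
  fun j => ![((s : ℤ) : ℝ), x 0, x 1, -((s : ℤ) : ℝ) * (x 0 * x 2 + x 1 * x 3), x 2, x 3] (j - i)

/-- The decomposable bivector of norm one with given coordinates. -/
noncomputable def chartInv (κ : SignType) (i : Fin 6) (s : ℤˣ) (x : EuclideanSpace ℝ (Fin 4)) :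
    Fin 6 → ℝ :=
  (√(pluckerNorm κ (chartLift i s x)))⁻¹ • chartLift i s x

lemma unit_mul_self (s : ℤˣ) : ((s : ℤ) : ℝ) * ((s : ℤ) : ℝ) = 1 := by
  rcases Int.units_eq_one_or s with rfl | rfl <;> simp

lemma pluckerNorm_smul (κ : SignType) (r : ℝ) (w : Fin 6 → ℝ) :
    pluckerNorm κ (r • w) = r ^ 2 * pluckerNorm κ w := by
  simp [pluckerNorm]; ring

lemma chartLift_decomposable (i : Fin 6) (s : ℤˣ) (x : EuclideanSpace ℝ (Fin 4)) :
    chartLift i s x 0 * chartLift i s x 3 + chartLift i s x 1 * chartLift i s x 4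
      + chartLift i s x 2 * chartLift i s x 5 = 0 := by
  have h := unit_mul_self s
  fin_cases i <;> simp [chartLift, Fin.sub_def] <;>
    linear_combination (-(x 0 * x 2 + x 1 * x 3)) * h

lemma chartInv_mem (κ : SignType) (i : Fin 6) (s : ℤˣ) {x : EuclideanSpace ℝ (Fin 4)}
    (h : 0 < pluckerNorm κ (chartLift i s x)) : chartInv κ i s x ∈ quadric κ := by
  constructor
  · have := chartLift_decomposable i s x
    simp only [chartInv, Pi.smul_apply, smul_eq_mul]
    linear_combination ((√(pluckerNorm κ (chartLift i s x)))⁻¹) ^ 2 * this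
  · rw [chartInv, pluckerNorm_smul, inv_pow, Real.sq_sqrt h.le, inv_mul_cancel₀ h.ne']

lemma chartLift_self (i : Fin 6) (s : ℤˣ) (x : EuclideanSpace ℝ (Fin 4)) :
    chartLift i s x i = (s : ℤ) := by
  simp [chartLift]

lemma chartInv_pos (κ : SignType) (i : Fin 6) (s : ℤˣ) {x : EuclideanSpace ℝ (Fin 4)}
    (h : 0 < pluckerNorm κ (chartLift i s x)) : 0 < (s : ℤ) * chartInv κ i s x i := by
  have h1 := Real.sqrt_pos.2 h
  rw [chartInv, Pi.smul_apply, chartLift_self, smul_eq_mul, mul_left_comm, unit_mul_self]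
  positivity

lemma chartFun_chartInv (κ : SignType) (i : Fin 6) (s : ℤˣ) {x : EuclideanSpace ℝ (Fin 4)}
    (h : 0 < pluckerNorm κ (chartLift i s x)) : chartFun i s (chartInv κ i s x) = x := by
  have h1 := Real.sqrt_pos.2 h
  have h2 : (s : ℤ) * chartInv κ i s x i = (√(pluckerNorm κ (chartLift i s x)))⁻¹ := by
    rw [chartInv, Pi.smul_apply, chartLift_self, smul_eq_mul, mul_left_comm, unit_mul_self, mul_one]
  ext k
  rw [chartFun, h2]
  simp only [chartInv, Pi.smul_apply, smul_eq_mul]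
  fin_cases k <;> simp [chartLift] <;> field_simp

lemma chartLift_chartFun (i : Fin 6) (s : ℤˣ) {w : Fin 6 → ℝ}
    (hw : w 0 * w 3 + w 1 * w 4 + w 2 * w 5 = 0) (h : 0 < (s : ℤ) * w i) :
    chartLift i s (chartFun i s w) = ((s : ℤ) * w i)⁻¹ • w := by
  have hs := unit_mul_self s
  have h3 : w i * w (i + 3) + w (i + 1) * w (i + 4) + w (i + 2) * w (i + 5) = 0 := by
    fin_cases i <;> simp [Fin.add_def] <;> linarith
  have hi : w i ≠ 0 := by rintro h0; simp [h0] at h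
  have hs0 : ((s : ℤ) : ℝ) ≠ 0 := by rintro h0; simp [h0] at h
  have key : ∀ k : Fin 6, chartLift i s (chartFun i s w) (i + k)
      = ((s : ℤ) * w i)⁻¹ * w (i + k) := by
    intro k
    simp only [chartLift, add_sub_cancel_left, chartFun]
    fin_cases k <;> simp <;> field_simp
    · linear_combination hs
    · linear_combination (-1 : ℝ) * h3
  ext j
  have := key (j - i)
  simpa using this

lemma pluckerNorm_chartLift (κ : SignType) (i : Fin 6) (s : ℤˣ) {w : Fin 6 → ℝ}
    (hw : w ∈ quadric κ) (h : 0 < (s : ℤ) * w i) :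
    pluckerNorm κ (chartLift i s (chartFun i s w)) = (((s : ℤ) * w i)⁻¹) ^ 2 := by
  rw [chartLift_chartFun i s hw.1 h, pluckerNorm_smul, hw.2, mul_one]

lemma chartInv_chartFun (κ : SignType) (i : Fin 6) (s : ℤˣ) {w : Fin 6 → ℝ}
    (hw : w ∈ quadric κ) (h : 0 < (s : ℤ) * w i) : chartInv κ i s (chartFun i s w) = w := by
  rw [chartInv, pluckerNorm_chartLift κ i s hw h, chartLift_chartFun i s hw.1 h,
    Real.sqrt_sq (by positivity), inv_inv, smul_smul, mul_inv_cancel₀ h.ne', one_smul]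

lemma contDiff_chartLift (i : Fin 6) (s : ℤˣ) : ContDiff ℝ ∞ (chartLift i s) := by
  have hx : ∀ k : Fin 4, ContDiff ℝ ∞ (fun x : EuclideanSpace ℝ (Fin 4) => x k) := fun k => by
    fun_prop
  rw [contDiff_pi]
  intro j
  simp only [chartLift]
  generalize j - i = k
  fin_cases k
  · exact contDiff_const
  · exact hx 0
  · exact hx 1
  · exact contDiff_const.mul (((hx 0).mul (hx 2)).add ((hx 1).mul (hx 3)))
  · exact hx 2
  · exact hx 3

lemma contDiff_pluckerNorm (κ : SignType) : ContDiff ℝ ∞ (pluckerNorm κ) := by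
  unfold pluckerNorm
  fun_prop

lemma contDiffOn_chartInv (κ : SignType) (i : Fin 6) (s : ℤˣ) :
    ContDiffOn ℝ ∞ (chartInv κ i s) {x | 0 < pluckerNorm κ (chartLift i s x)} := by
  have h : ContDiffOn ℝ ∞ (fun x => pluckerNorm κ (chartLift i s x))
      {x | 0 < pluckerNorm κ (chartLift i s x)} :=
    ((contDiff_pluckerNorm κ).comp (contDiff_chartLift i s)).contDiffOn
  exact ((h.sqrt fun x hx => (ne_of_gt hx)).inv
    fun x hx => (Real.sqrt_pos.2 hx).ne').smul (contDiff_chartLift i s).contDiffOn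

lemma contDiffOn_chartFun (i : Fin 6) (s : ℤˣ) :
    ContDiffOn ℝ ∞ (chartFun i s) {w | 0 < (s : ℤ) * w i} := by
  have h : ∀ j : Fin 6, ContDiffOn ℝ ∞ (fun w : Fin 6 → ℝ => w j / ((s : ℤ) * w i))
      {w | 0 < (s : ℤ) * w i} := by
    intro j
    refine ContDiffOn.div (by fun_prop) (by fun_prop) fun w hw => ne_of_gt hw
  rw [contDiffOn_euclidean]
  intro k
  fin_cases k
  · exact h (i + 1)
  · exact h (i + 2)
  · exact h (i + 4)
  · exact h (i + 5)

namespace OrientedGeodesic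

variable (κ : SignType)

/-- The chart of `𝒢_κ` on the set where the Plücker coordinate with index `i` has the sign `s`. -/
noncomputable def pluckerChart (i : Fin 6) (s : ℤˣ) :
    OpenPartialHomeomorph (OrientedGeodesic κ) (EuclideanSpace ℝ (Fin 4)) where
  toFun l := chartFun i s (plucker l)
  invFun x := ofPlucker κ (chartInv κ i s x)
  source := {l | 0 < (s : ℤ) * plucker l i}
  target := {x | 0 < pluckerNorm κ (chartLift i s x)}
  map_source' := by
    intro l hl
    rw [mem_ofPred_eq]
    rw [pluckerNorm_chartLift κ i s (plucker_mem l) hl]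
    have : (0 : ℝ) < (s : ℤ) * plucker l i := hl
    positivity
  map_target' := by
    intro x hx
    rw [mem_ofPred_eq]
    rw [plucker_ofPlucker (chartInv_mem κ i s hx)]
    exact chartInv_pos κ i s hx
  left_inv' := by
    intro l hl
    apply plucker_injective
    rw [chartInv_chartFun κ i s (plucker_mem l) hl, plucker_ofPlucker (plucker_mem l)]
  right_inv' := by
    intro x hx
    rw [plucker_ofPlucker (chartInv_mem κ i s hx), chartFun_chartInv κ i s hx]
  open_source := by
    have h : Continuous fun l : OrientedGeodesic κ => ((s : ℤ) : ℝ) * plucker l i :=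
      continuous_const.mul ((continuous_apply i).comp continuous_plucker)
    exact isOpen_lt continuous_const h
  open_target :=
    isOpen_lt continuous_const
      ((contDiff_pluckerNorm κ).continuous.comp (contDiff_chartLift i s).continuous)
  continuousOn_toFun :=
    (contDiffOn_chartFun i s).continuousOn.comp continuous_plucker.continuousOn fun _ h => h
  continuousOn_invFun := by
    rw [isInducing_plucker.continuousOn_iff]
    refine (contDiffOn_chartInv κ i s).continuousOn.congr fun x hx => ?_
    exact plucker_ofPlucker (chartInv_mem κ i s hx)

lemma exists_mem_source (l : OrientedGeodesic κ) :
    ∃ is : Fin 6 × ℤˣ, l ∈ (pluckerChart κ is.1 is.2).source := by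
  have h : ∃ i, plucker l i ≠ 0 := by
    by_contra! h
    have := (plucker_mem l).2
    simp [pluckerNorm, h] at this
  obtain ⟨i, hi⟩ := h
  rcases lt_or_gt_of_ne hi with hi | hi
  · refine ⟨(i, -1), ?_⟩
    show l ∈ {l | (0 : ℝ) < _}
    rw [mem_ofPred_eq]
    simpa using hi
  · refine ⟨(i, 1), ?_⟩
    show l ∈ {l | (0 : ℝ) < _}
    rw [mem_ofPred_eq]
    simpa using hi

noncomputable instance : ChartedSpace (EuclideanSpace ℝ (Fin 4)) (OrientedGeodesic κ) where
  atlas := range fun is : Fin 6 × ℤˣ => pluckerChart κ is.1 is.2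
  chartAt l := pluckerChart κ (exists_mem_source κ l).choose.1 (exists_mem_source κ l).choose.2
  mem_chart_source l := (exists_mem_source κ l).choose_spec
  chart_mem_atlas _ := mem_range_self _

instance : IsManifold (𝓡 4) ∞ (OrientedGeodesic κ) := by
  apply isManifold_of_contDiffOn
  rintro _ _ ⟨⟨i, s⟩, rfl⟩ ⟨⟨j, t⟩, rfl⟩
  have h : ContDiffOn ℝ ∞ (fun x => chartFun j t (chartInv κ i s x))
      {x | 0 < pluckerNorm κ (chartLift i s x) ∧ 0 < (t : ℤ) * chartInv κ i s x j} :=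
    (contDiffOn_chartFun j t).comp ((contDiffOn_chartInv κ i s).mono fun x hx => hx.1)
      fun x hx => hx.2
  have hsub : ∀ x ∈ (pluckerChart κ i s).symm.source ∩
      (pluckerChart κ i s).symm ⁻¹' (pluckerChart κ j t).source,
      (0 < pluckerNorm κ (chartLift i s x) ∧ 0 < (t : ℤ) * chartInv κ i s x j) ∧
      plucker (ofPlucker κ (chartInv κ i s x)) = chartInv κ i s x := by
    rintro x ⟨hx, hx'⟩
    have e := plucker_ofPlucker (chartInv_mem κ i s hx)
    have hx'' : (0 : ℝ) < (t : ℤ) * plucker (ofPlucker κ (chartInv κ i s x)) j := hx'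
    rw [e] at hx''
    exact ⟨⟨hx, hx''⟩, e⟩
  have h' := h.mono fun x hx => (hsub x hx).1
  simp only [modelWithCornersSelf_coe, modelWithCornersSelf_coe_symm, Function.id_comp,
    Function.comp_id, preimage_id, range_id, inter_univ]
  refine ContDiffOn.congr (h'.mono ?_) ?_
  · intro x hx
    rwa [OpenPartialHomeomorph.trans_source] at hx
  · intro x hx
    rw [OpenPartialHomeomorph.trans_source] at hx
    show chartFun j t (plucker (ofPlucker κ (chartInv κ i s x))) = _
    rw [(hsub x hx).2]

end OrientedGeodesic

/-! ### Helicoidal curves and admissible vectors -/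

/-- `Γ` is the `α`-helicoidal curve in `𝒢_κ` with initial ray `l` and axis the geodesic `γ_A` with
initial velocity `A`, where `p ∈ l` and `A ∈ T_p M_κ` is a unit vector orthogonal to `l`: with
`σ` the parametrization of `l` with `σ(0) = p`, and `V`, `B` the parallel fields along `γ_A` with
initial values `σ'(0)` and `A × σ'(0)`, the oriented geodesic `Γ(t)` has the initial velocity
`cos(αt) V(t) + sin(αt) B(t)` at `γ_A(t)`. -/
def IsHelicoidalCurve (κ : SignType) (α : ℝ) (l : OrientedGeodesic κ) (p A : Fin 4 → ℝ)
    (Γ : ℝ → OrientedGeodesic κ) : Prop :=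
  ∃ (σ γ : UnitGeodesic κ) (V B : ℝ → Fin 4 → ℝ),
    l = Quotient.mk _ σ ∧ σ.curve 0 = p ∧
    γ.curve 0 = p ∧ deriv γ.curve 0 = A ∧ form κ A (deriv σ.curve 0) = 0 ∧
    IsParallelAlong κ γ.curve V ∧ V 0 = deriv σ.curve 0 ∧
    IsParallelAlong κ γ.curve B ∧ IsCross κ p A (deriv σ.curve 0) (B 0) ∧
    ∀ t, ∃ τ : UnitGeodesic κ, Γ t = Quotient.mk _ τ ∧ τ.curve 0 = γ.curve t ∧
      deriv τ.curve 0 = Real.cos (α * t) • V t + Real.sin (α * t) • B t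

/-- The set `𝒜_κ^α ⊆ T𝒢_κ` of the initial velocities of `α`-helicoidal curves, with the subspace
topology. -/
def admissible (κ : SignType) (α : ℝ) : Set (TangentBundle (𝓡 4) (OrientedGeodesic κ)) :=
  {v | ∃ l p A Γ, IsHelicoidalCurve κ α l p A Γ ∧ MDifferentiableAt 𝓘(ℝ, ℝ) (𝓡 4) Γ 0 ∧
    v = ⟨Γ 0, mfderiv 𝓘(ℝ, ℝ) (𝓡 4) Γ 0 (1 : ℝ)⟩}

/-- The canonical projection `𝒜_κ^α → 𝒢_κ`. -/
def admissibleProj (κ : SignType) (α : ℝ) (v : admissible κ α) : OrientedGeodesic κ := v.1.proj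

/-- The fiber of `𝒜_κ^α → 𝒢_κ` over `l`. -/
abbrev admissibleFiber (κ : SignType) (α : ℝ) (l : OrientedGeodesic κ) : Type :=
  {v : admissible κ α // admissibleProj κ α v = l}

end Helicoid

/-!
Let `ℝ[ω]`, with `ω² = κ`, be the ring of split-complex, dual or complex numbers. The bivectors of
`ℝ⁴`, hence the Plücker coordinates of geodesics, are vectors of `ℝ[ω]³`, and `𝒢_κ` is the unit
sphere of the standard bilinear form of `ℝ[ω]³` (`mem_quadric_iff`). A helicoidal curve whose axis
has the initial velocity `A` at `p`, whose initial ray has the direction `u` there, and with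
`B = A × u`, has the initial velocity
`A ∧ u + α (p ∧ B) = (α + ω) (p ∧ B)` in Plücker coordinates
(`IsHelicoidalCurve.exists_hasDerivAt`). The pair of `p ∧ u` and `p ∧ B` is orthonormal over `ℝ[ω]`,
and all orthonormal pairs arise in this way (`exists_frame_of_mem_dualPairs`). As
`(α + ω) (α - ω) = α² - κ`, the number `α + ω` is invertible for `α² ≠ κ`, and then `𝒜_κ^α` is
homeomorphic to the space `dualPairs κ` of orthonormal pairs over `ℝ[ω]`, which is a copy of
`SO(3, ℝ[ω])` (`exists_homeomorph_dualPairs`). The homeomorphism is obtained from the embedding of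
`T𝒢_κ` into `ℝ⁶ × ℝ⁶` by the Plücker coordinates and their differentials
(`isEmbedding_tangentPlucker`).

The invariant that tells `𝒜_κ^α` from the product is the existence of continuous logarithms of
all continuous functions with values in `ℂ ∖ {0}`, in other words the vanishing of `H¹(X, ℤ)`.

* `SO(3)` has this property: it is the quotient of a closed ball by the antipodal map on the
  boundary (`hasContinuousLogs_orthoPairs`). It passes to retracts, and to products with compact
  connected spaces (`HasContinuousLogs.prod`). The space `SO(3, ℝ[ω])` is `SO(3) × SO(3)` for
  `κ = 1`, as `ℝ[ω] ≅ ℝ × ℝ`, and `ℝ³ × SO(3)` for `κ ≤ 0`, by the Cartan decomposition. So it has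
  the property (`hasContinuousLogs_dualPairs`).
* The fiber of `SO(3, ℝ[ω])` over `𝒢_κ` is the unit circle `X² + Y² = 1` over `ℝ[ω]`, which
  contains the real unit circle; the function `(X.re + X.im) + i (Y.re + Y.im)` has no zeros on the
  fiber and winds once around `0` along the real circle. So `𝒢_κ × 𝓕` does not have the property
  (`not_hasContinuousLogs_prod_fiber`).

If the bundle were trivial with some fiber `F`, then `F` would be homeomorphic to `𝓕`; so the
statement on the product implies the one on the bundle.
-/

namespace Helicoid

/-! ### Continuous logarithms -/

/-- Every continuous map from `X` to `ℂ ∖ {0}` has a continuous logarithm. -/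
def HasContinuousLogs (X : Type*) [TopologicalSpace X] : Prop :=
  ∀ f : X → ℂ, Continuous f → (∀ x, f x ≠ 0) →
    ∃ g : X → ℂ, Continuous g ∧ ∀ x, Complex.exp (g x) = f x

lemma eq_of_exp_comp_eq {X : Type*} [TopologicalSpace X] [PreconnectedSpace X] {g₁ g₂ : X → ℂ}
    (h₁ : Continuous g₁) (h₂ : Continuous g₂)
    (h : ∀ x, Complex.exp (g₁ x) = Complex.exp (g₂ x)) {x₀ : X} (h₀ : g₁ x₀ = g₂ x₀) : g₁ = g₂ :=
  Complex.isCoveringMap_exp.eq_of_comp_eq h₁ h₂ (funext fun x => Subtype.ext (h x)) x₀ h₀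

lemma hasContinuousLogs_of_convex {E : Type*} [NormedAddCommGroup E] [NormedSpace ℝ E] {s : Set E}
    (hs : Convex ℝ s) (hne : s.Nonempty) : HasContinuousLogs s := by
  intro f hf h0
  have := hs.contractibleSpace hne
  have := hs.locallyPathConnectedSpace
  obtain ⟨x₀, hx₀⟩ := hne
  obtain ⟨g, ⟨-, hg⟩, -⟩ := Complex.isCoveringMapOn_exp.existsUnique_continuousMap_lifts
    (⟨f, hf⟩ : C(s, ℂ)) (a₀ := ⟨x₀, hx₀⟩) (Complex.exp_log (h0 _)) h0
  exact ⟨g, g.continuous, fun x => congrFun hg x⟩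

namespace HasContinuousLogs

variable {X Y : Type*} [TopologicalSpace X] [TopologicalSpace Y]

lemma of_retract (h : HasContinuousLogs Y) {q : Y → X} {r : X → Y} (hq : Continuous q)
    (hr : Continuous r) (hqr : ∀ x, q (r x) = x) : HasContinuousLogs X := by
  intro f hf h0
  obtain ⟨g, hg, hgf⟩ := h (f ∘ q) (hf.comp hq) fun y => h0 (q y)
  exact ⟨g ∘ r, hg.comp hr, fun x => by simp [hgf, hqr]⟩

/-- The logarithms along the slices `{x} × Y`, normalized on `X × {y₀}`, fit together: near the
slice over `x₁` they are obtained from the logarithm there by adding the principal logarithm of the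
ratio of the functions. -/
lemma prod [CompactSpace Y] [ConnectedSpace Y] (hX : HasContinuousLogs X)
    (hY : HasContinuousLogs Y) : HasContinuousLogs (X × Y) := by
  intro f hf h0
  obtain ⟨y₀⟩ : Nonempty Y := inferInstance
  obtain ⟨a, ha, haf⟩ := hX (fun x => f (x, y₀)) (by fun_prop) fun x => h0 _
  choose b hb hbf using fun x => hY (fun y => f (x, y)) (by fun_prop) fun y => h0 _
  refine ⟨fun z => b z.1 z.2 + (a z.1 - b z.1 y₀), ?_, ?_⟩
  swap
  · rintro ⟨x, y⟩
    simp only [Complex.exp_add, Complex.exp_sub, hbf, haf]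
    rw [div_self (h0 _), mul_one]
  rw [continuous_iff_continuousAt]
  rintro ⟨x₁, y₁⟩
  set ρ : X × Y → ℂ := fun z => f z / f (x₁, z.2) with hρ
  have hρc : Continuous ρ := hf.div (by fun_prop) fun z => h0 _
  have hU : IsOpen (ρ ⁻¹' Complex.slitPlane) := Complex.isOpen_slitPlane.preimage hρc
  obtain ⟨v, w, hv, -, hxv, hyw, hvw⟩ := generalized_tube_lemma (isCompact_singleton (x := x₁))
    (isCompact_univ (X := Y)) hU (by
      rintro ⟨x, y⟩ ⟨hx, -⟩
      obtain rfl : x = x₁ := hx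
      simp [hρ, div_self (h0 _)])
  have hxv : x₁ ∈ v := hxv rfl
  have hmem : ∀ x ∈ v, ∀ y, ρ (x, y) ∈ Complex.slitPlane := fun x hx y =>
    hvw ⟨hx, hyw (mem_univ y)⟩
  have hlog : ∀ x ∈ v, ∀ y, Complex.exp (Complex.log (ρ (x, y))) = f (x, y) / f (x₁, y) :=
    fun x hx y => Complex.exp_log (Complex.slitPlane_ne_zero (hmem x hx y))
  have key : ∀ x ∈ v, ∀ y, b x y + (a x - b x y₀) =
      b x₁ y + Complex.log (ρ (x, y)) + (a x - b x₁ y₀ - Complex.log (ρ (x, y₀))) := by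
    intro x hx y
    have hc : Continuous fun y => Complex.log (ρ (x, y)) :=
      Continuous.clog (by fun_prop) (hmem x hx)
    have h1 : Continuous fun y => b x y + (a x - b x y₀) := (hb x).add continuous_const
    have h2 : Continuous fun y => b x₁ y + Complex.log (ρ (x, y))
        + (a x - b x₁ y₀ - Complex.log (ρ (x, y₀))) := ((hb x₁).add hc).add continuous_const
    refine congrFun (eq_of_exp_comp_eq h1 h2 ?_ (x₀ := y₀) (by ring)) y
    intro y
    have e1 := h0 (x₁, y)
    have e2 := h0 (x₁, y₀)
    have e3 := h0 (x, y₀)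
    simp only [Complex.exp_add, Complex.exp_sub, hbf, haf, hlog x hx]
    field_simp
  have hcont : ContinuousAt (fun z : X × Y => b x₁ z.2 + Complex.log (ρ z)
      + (a z.1 - b x₁ y₀ - Complex.log (ρ (z.1, y₀)))) (x₁, y₁) := by
    have c1 : ContinuousAt (fun z : X × Y => Complex.log (ρ z)) (x₁, y₁) :=
      hρc.continuousAt.clog (hmem x₁ hxv y₁)
    have c2 : ContinuousAt (fun z : X × Y => Complex.log (ρ (z.1, y₀))) (x₁, y₁) :=
      ContinuousAt.clog (by fun_prop) (hmem x₁ hxv y₀)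
    have c3 : Continuous fun z : X × Y => b x₁ z.2 := (hb x₁).comp continuous_snd
    have c4 : Continuous fun z : X × Y => a z.1 - b x₁ y₀ :=
      (ha.comp continuous_fst).sub continuous_const
    exact (c3.continuousAt.add c1).add (c4.continuousAt.sub c2)
  refine hcont.congr ?_
  filter_upwards [(hv.prod isOpen_univ).mem_nhds (show (x₁, y₁) ∈ v ×ˢ univ from ⟨hxv, trivial⟩)]
    with z hz
  exact (key z.1 hz.1 z.2).symm

/-- A function that winds once around `0` along a loop has no continuous logarithm. -/
lemma not_of_loop {f : X → ℂ} (hf : Continuous f) (h0 : ∀ x, f x ≠ 0) {c : ℝ → X}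
    (hc : Continuous c) (hper : c (2 * Real.pi) = c 0)
    (hfc : ∀ θ : ℝ, f (c θ) = Complex.exp (θ * Complex.I)) : ¬ HasContinuousLogs X := by
  intro h
  obtain ⟨g, hg, hgf⟩ := h f hf h0
  have h1 : Continuous fun θ : ℝ => g (c θ) - g (c 0) := (hg.comp hc).sub continuous_const
  have h2 : Continuous fun θ : ℝ => (θ : ℂ) * Complex.I := by fun_prop
  have := congrFun (eq_of_exp_comp_eq h1 h2 (fun θ => by
    rw [Complex.exp_sub, hgf, hgf, hfc, hfc]; simp) (x₀ := 0) (by simp)) (2 * Real.pi)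
  simp [hper, Real.pi_ne_zero] at this

end HasContinuousLogs

/-! ### Continuous logarithms on `SO(3)` -/

/-- Orthonormal pairs of vectors in `ℝ³`, as a model of `SO(3)`. -/
def orthoPairs : Set ((Fin 3 → ℝ) × (Fin 3 → ℝ)) :=
  {z | z.1 ⬝ᵥ z.1 = 1 ∧ z.2 ⬝ᵥ z.2 = 1 ∧ z.1 ⬝ᵥ z.2 = 0}

/-- The images of the first two basis vectors of `ℝ³` under `v ↦ q v q̄`, where `q` is the
quaternion `w + x i + y j + z k`. -/
def quatPair (w x y z : ℝ) : (Fin 3 → ℝ) × (Fin 3 → ℝ) :=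
  (![w ^ 2 + x ^ 2 - y ^ 2 - z ^ 2, 2 * (x * y + w * z), 2 * (x * z - w * y)],
   ![2 * (x * y - w * z), w ^ 2 - x ^ 2 + y ^ 2 - z ^ 2, 2 * (y * z + w * x)])

lemma quatPair_mem {w x y z : ℝ} (h : w ^ 2 + x ^ 2 + y ^ 2 + z ^ 2 = 1) :
    quatPair w x y z ∈ orthoPairs := by
  refine ⟨?_, ?_, ?_⟩ <;> simp only [quatPair, dotProduct, Fin.sum_univ_three, Matrix.cons_val]
  · linear_combination (w ^ 2 + x ^ 2 + y ^ 2 + z ^ 2 + 1) * h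
  · linear_combination (w ^ 2 + x ^ 2 + y ^ 2 + z ^ 2 + 1) * h
  · ring

lemma exists_half_angle {c s : ℝ} (h : c ^ 2 + s ^ 2 = 1) :
    ∃ a b : ℝ, a ^ 2 + b ^ 2 = 1 ∧ a ^ 2 - b ^ 2 = c ∧ 2 * a * b = s := by
  obtain ⟨t, rfl, rfl⟩ : ∃ t, Real.cos t = c ∧ Real.sin t = s := by
    simpa [cosK, sinK] using exists_cosK_sinK 1 (by simpa using h) (fun h => absurd rfl h)
  refine ⟨Real.cos (t / 2), Real.sin (t / 2), Real.cos_sq_add_sin_sq _, ?_, ?_⟩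
  · rw [← Real.cos_two_mul', mul_div_cancel₀ _ two_ne_zero]
  · rw [mul_right_comm, ← Real.sin_two_mul, mul_div_cancel₀ _ two_ne_zero]

lemma exists_quat_fst {a : Fin 3 → ℝ} (ha : a ⬝ᵥ a = 1) :
    ∃ w x y z : ℝ, w ^ 2 + x ^ 2 + y ^ 2 + z ^ 2 = 1 ∧ (quatPair w x y z).1 = a := by
  simp only [dotProduct, Fin.sum_univ_three] at ha
  by_cases h : 1 + a 0 = 0
  · have h0 : a 0 = -1 := by linarith
    rw [h0] at ha
    have h1 : a 1 = 0 := by nlinarith [sq_nonneg (a 1), sq_nonneg (a 2)]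
    have h2 : a 2 = 0 := by nlinarith [sq_nonneg (a 1), sq_nonneg (a 2)]
    refine ⟨0, 0, 1, 0, by norm_num, ?_⟩
    ext i; fin_cases i <;> simp [quatPair, h0, h1, h2]
  · have hp : 0 < 1 + a 0 := by
      refine lt_of_le_of_ne ?_ (Ne.symm h)
      nlinarith [sq_nonneg (a 1), sq_nonneg (a 2)]
    obtain ⟨r, hr0, hr⟩ : ∃ r : ℝ, 0 < r ∧ r ^ 2 * (2 * (1 + a 0)) = 1 :=
      ⟨(√(2 * (1 + a 0)))⁻¹, by positivity, by
        rw [inv_pow, Real.sq_sqrt (by positivity), inv_mul_cancel₀ (by positivity)]⟩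
    refine ⟨r * (1 + a 0), 0, -r * a 2, r * a 1, ?_, ?_⟩
    · linear_combination hr + r ^ 2 * ha
    · ext i
      fin_cases i <;> simp [quatPair]
      · linear_combination a 0 * hr - r ^ 2 * ha
      · linear_combination a 1 * hr
      · linear_combination a 2 * hr

/-- Every rotation of `ℝ³` is conjugation by a unit quaternion. -/
lemma exists_quatPair_eq {z : (Fin 3 → ℝ) × (Fin 3 → ℝ)} (hz : z ∈ orthoPairs) :
    ∃ p q r s : ℝ, p ^ 2 + q ^ 2 + r ^ 2 + s ^ 2 = 1 ∧ quatPair p q r s = z := by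
  obtain ⟨a, b⟩ := z
  obtain ⟨haa, hbb, hab⟩ := hz
  simp only at haa hbb hab
  obtain ⟨w, x, y, z, h1, rfl⟩ := exists_quat_fst haa
  simp only [quatPair, dotProduct, Fin.sum_univ_three, Matrix.cons_val] at hbb hab
  -- the coordinates of `b` with respect to the images of the second and third basis vectors
  set c := 2 * (x * y - w * z) * b 0 + (w ^ 2 - x ^ 2 + y ^ 2 - z ^ 2) * b 1
    + 2 * (y * z + w * x) * b 2 with hc
  set d := 2 * (x * z + w * y) * b 0 + 2 * (y * z - w * x) * b 1
    + (w ^ 2 - x ^ 2 - y ^ 2 + z ^ 2) * b 2 with hd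
  have h2 : (w ^ 2 + x ^ 2 + y ^ 2 + z ^ 2) ^ 2 = 1 := by rw [h1, one_pow]
  have hcd : c ^ 2 + d ^ 2 = 1 := by
    linear_combination hbb + (b 0 * b 0 + b 1 * b 1 + b 2 * b 2) * h2
      - ((w ^ 2 + x ^ 2 - y ^ 2 - z ^ 2) * b 0 + 2 * (x * y + w * z) * b 1
        + 2 * (x * z - w * y) * b 2) * hab
  obtain ⟨k, l, hkl, hk, hl⟩ := exists_half_angle hcd
  refine ⟨w * k - x * l, w * l + x * k, y * k + z * l, z * k - y * l, ?_, ?_⟩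
  · linear_combination h1 + (w ^ 2 + x ^ 2 + y ^ 2 + z ^ 2) * hkl
  · refine Prod.ext ?_ ?_
    · ext i
      fin_cases i <;> simp [quatPair]
      · linear_combination (w ^ 2 + x ^ 2 - y ^ 2 - z ^ 2) * hkl
      · linear_combination (x * y + w * z) * hkl
      · linear_combination (x * z - w * y) * hkl
    · ext i
      fin_cases i <;> simp [quatPair]
      · linear_combination 2 * (x * y - w * z) * (hk + hc) + 2 * (x * z + w * y) * (hl + hd)
          + b 0 * h2 - (w ^ 2 + x ^ 2 - y ^ 2 - z ^ 2) * hab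
      · linear_combination (w ^ 2 - x ^ 2 + y ^ 2 - z ^ 2) * (hk + hc)
          + 2 * (y * z - w * x) * (hl + hd) + b 1 * h2 - 2 * (x * y + w * z) * hab
      · linear_combination 2 * (y * z + w * x) * (hk + hc)
          + (w ^ 2 - x ^ 2 - y ^ 2 + z ^ 2) * (hl + hd) + b 2 * h2 - 2 * (x * z - w * y) * hab

lemma eq_zero_of_sum_four_sq {a b c d : ℝ} (h : a ^ 2 + b ^ 2 + c ^ 2 + d ^ 2 = 0) :
    a = 0 ∧ b = 0 ∧ c = 0 ∧ d = 0 := by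
  have ha := sq_nonneg a
  have hb := sq_nonneg b
  have hc := sq_nonneg c
  have hd := sq_nonneg d
  refine ⟨?_, ?_, ?_, ?_⟩ <;> exact pow_eq_zero_iff two_ne_zero |>.1 (by linarith)

/-- Two unit quaternions that define the same rotation agree up to sign, because the rotation
determines the products of any two of the coordinates. -/
lemma quatPair_eq_iff {p q r s w x y z : ℝ} (h : p ^ 2 + q ^ 2 + r ^ 2 + s ^ 2 = 1)
    (h' : w ^ 2 + x ^ 2 + y ^ 2 + z ^ 2 = 1) (he : quatPair p q r s = quatPair w x y z) :
    (p = w ∧ q = x ∧ r = y ∧ s = z) ∨ (p = -w ∧ q = -x ∧ r = -y ∧ s = -z) := by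
  have e := Prod.ext_iff.1 he
  have a0 := congrFun e.1 0
  have a1 := congrFun e.1 1
  have a2 := congrFun e.1 2
  have b0 := congrFun e.2 0
  have b1 := congrFun e.2 1
  have b2 := congrFun e.2 2
  simp only [quatPair, Matrix.cons_val] at a0 a1 a2 b0 b1 b2
  -- the image of the third basis vector is the cross product of the other two
  have c0 : 2 * (q * s + p * r) = 2 * (x * z + w * y) := by
    linear_combination (-2 * (q * s + p * r)) * h + 2 * (x * z + w * y) * h'
      + a1 * (2 * (r * s + p * q)) + 2 * (x * y + w * z) * b2
      - a2 * (p ^ 2 - q ^ 2 + r ^ 2 - s ^ 2) - 2 * (x * z - w * y) * b1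
  have c1 : 2 * (r * s - p * q) = 2 * (y * z - w * x) := by
    linear_combination (-2 * (r * s - p * q)) * h + 2 * (y * z - w * x) * h'
      + a2 * (2 * (q * r - p * s)) + 2 * (x * z - w * y) * b0
      - a0 * (2 * (r * s + p * q)) - (w ^ 2 + x ^ 2 - y ^ 2 - z ^ 2) * b2
  have c2 : p ^ 2 - q ^ 2 - r ^ 2 + s ^ 2 = w ^ 2 - x ^ 2 - y ^ 2 + z ^ 2 := by
    linear_combination (-(p ^ 2 - q ^ 2 - r ^ 2 + s ^ 2)) * h
      + (w ^ 2 - x ^ 2 - y ^ 2 + z ^ 2) * h'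
      + a0 * (p ^ 2 - q ^ 2 + r ^ 2 - s ^ 2) + (w ^ 2 + x ^ 2 - y ^ 2 - z ^ 2) * b1
      - a1 * (2 * (q * r - p * s)) - 2 * (x * y + w * z) * b0
  have pp : p * p = w * w := by linarith
  have qq : q * q = x * x := by linarith
  have rr : r * r = y * y := by linarith
  have ss : s * s = z * z := by linarith
  have pq : p * q = w * x := by linarith
  have pr : p * r = w * y := by linarith
  have ps : p * s = w * z := by linarith
  have qr : q * r = x * y := by linarith
  have qs : q * s = x * z := by linarith
  have rs : r * s = y * z := by linarith
  have hd : (p * w + q * x + r * y + s * z) ^ 2 = 1 := by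
    have : (p * w + q * x + r * y + s * z) ^ 2 = (p ^ 2 + q ^ 2 + r ^ 2 + s ^ 2) ^ 2 := by
      linear_combination (-p * p) * pp - q * q * qq - r * r * rr - s * s * ss - 2 * p * q * pq
        - 2 * p * r * pr - 2 * p * s * ps - 2 * q * r * qr - 2 * q * s * qs - 2 * r * s * rs
    rw [this, h, one_pow]
  rcases sq_eq_one_iff.1 hd with hd | hd
  · left
    have hs : (p - w) ^ 2 + (q - x) ^ 2 + (r - y) ^ 2 + (s - z) ^ 2 = 0 := by
      linear_combination h + h' - 2 * hd
    obtain ⟨e1, e2, e3, e4⟩ := eq_zero_of_sum_four_sq hs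
    exact ⟨by linarith, by linarith, by linarith, by linarith⟩
  · right
    have hs : (p + w) ^ 2 + (q + x) ^ 2 + (r + y) ^ 2 + (s + z) ^ 2 = 0 := by
      linear_combination h + h' + 2 * hd
    obtain ⟨e1, e2, e3, e4⟩ := eq_zero_of_sum_four_sq hs
    exact ⟨by linarith, by linarith, by linarith, by linarith⟩

/-- The unit quaternion with real part `≥ 0` and imaginary part `v` gives a parametrization of the
rotations by the closed unit ball. -/
noncomputable def ballRotation (v : EuclideanSpace ℝ (Fin 3)) : (Fin 3 → ℝ) × (Fin 3 → ℝ) :=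
  quatPair (√(1 - ‖v‖ ^ 2)) (v 0) (v 1) (v 2)

lemma norm_sq_euclidean_three (v : EuclideanSpace ℝ (Fin 3)) :
    ‖v‖ ^ 2 = v 0 ^ 2 + v 1 ^ 2 + v 2 ^ 2 := by
  simp [EuclideanSpace.norm_sq_eq, Fin.sum_univ_three]

lemma ballRotation_norm {v : EuclideanSpace ℝ (Fin 3)} (hv : ‖v‖ ≤ 1) :
    √(1 - ‖v‖ ^ 2) ^ 2 + v 0 ^ 2 + v 1 ^ 2 + v 2 ^ 2 = 1 := by
  rw [Real.sq_sqrt (by nlinarith [norm_nonneg v]), norm_sq_euclidean_three]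
  ring

lemma continuous_ballRotation : Continuous ballRotation := by
  unfold ballRotation quatPair
  fun_prop

lemma exists_ballRotation_eq {z : (Fin 3 → ℝ) × (Fin 3 → ℝ)} (hz : z ∈ orthoPairs) :
    ∃ v : EuclideanSpace ℝ (Fin 3), ‖v‖ ≤ 1 ∧ ballRotation v = z := by
  obtain ⟨p, q, r, s, h, rfl⟩ := exists_quatPair_eq hz
  wlog hp : 0 ≤ p generalizing p q r s
  · obtain ⟨v, hv, hv'⟩ := this (-p) (-q) (-r) (-s) (by linarith)
      (quatPair_mem (by linarith)) (by linarith)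
    exact ⟨v, hv, by rw [hv']; simp [quatPair]⟩
  · have hn : ‖!₂[q, r, s]‖ ^ 2 = 1 - p ^ 2 := by
      rw [norm_sq_euclidean_three]; simp; linarith
    refine ⟨!₂[q, r, s], ?_, ?_⟩
    · rw [← sq_le_one_iff₀ (norm_nonneg _), hn]; nlinarith
    · rw [ballRotation, hn, sub_sub_cancel, Real.sqrt_sq hp]; simp

lemma eq_or_antipodal_of_ballRotation_eq {v w : EuclideanSpace ℝ (Fin 3)} (hv : ‖v‖ ≤ 1)
    (hw : ‖w‖ ≤ 1) (h : ballRotation v = ballRotation w) : v = w ∨ ‖v‖ = 1 ∧ w = -v := by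
  rcases quatPair_eq_iff (ballRotation_norm hv) (ballRotation_norm hw) h with
    ⟨-, h0, h1, h2⟩ | ⟨hp, h0, h1, h2⟩
  · left; ext i; fin_cases i <;> assumption
  · right
    have h3 : √(1 - ‖v‖ ^ 2) = 0 :=
      le_antisymm (by rw [hp]; exact neg_nonpos.2 (Real.sqrt_nonneg _)) (Real.sqrt_nonneg _)
    rw [Real.sqrt_eq_zero (by nlinarith [norm_nonneg v])] at h3
    refine ⟨by nlinarith [norm_nonneg v], ?_⟩
    ext i; fin_cases i <;> simp [h0, h1, h2]

lemma ballRotation_neg {v : EuclideanSpace ℝ (Fin 3)} (hv : ‖v‖ = 1) :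
    ballRotation (-v) = ballRotation v := by
  simp [ballRotation, hv, quatPair]

/-- The parametrization of `orthoPairs` by the closed unit ball. -/
noncomputable def ballToOrthoPairs (v : Metric.closedBall (0 : EuclideanSpace ℝ (Fin 3)) 1) :
    orthoPairs :=
  ⟨ballRotation v, quatPair_mem (ballRotation_norm (mem_closedBall_zero_iff.1 v.2))⟩

lemma continuous_ballToOrthoPairs : Continuous ballToOrthoPairs :=
  (continuous_ballRotation.comp continuous_subtype_val).subtype_mk _

lemma surjective_ballToOrthoPairs : Function.Surjective ballToOrthoPairs := by
  rintro ⟨z, hz⟩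
  obtain ⟨v, hv, rfl⟩ := exists_ballRotation_eq hz
  exact ⟨⟨v, by simpa using hv⟩, rfl⟩

instance : CompactSpace orthoPairs :=
  surjective_ballToOrthoPairs.compactSpace continuous_ballToOrthoPairs

instance : ConnectedSpace orthoPairs := by
  have : ConnectedSpace (Metric.closedBall (0 : EuclideanSpace ℝ (Fin 3)) 1) :=
    isConnected_iff_connectedSpace.1
      ((convex_closedBall _ _).isConnected ⟨0, by simp⟩)
  exact surjective_ballToOrthoPairs.connectedSpace continuous_ballToOrthoPairs

/-- A logarithm `g` on the closed ball takes equal values at antipodal points of the sphere: the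
difference `g (-v) - g v` is constant on the sphere, as it lies in `2πiℤ`, and it is odd. -/
lemma hasContinuousLogs_orthoPairs : HasContinuousLogs orthoPairs := by
  intro f hf h0
  obtain ⟨g, hg, hgf⟩ := hasContinuousLogs_of_convex
    (convex_closedBall (0 : EuclideanSpace ℝ (Fin 3)) 1) ⟨0, by simp⟩ (f ∘ ballToOrthoPairs)
    (hf.comp continuous_ballToOrthoPairs) fun v => h0 _
  let i : Metric.sphere (0 : EuclideanSpace ℝ (Fin 3)) 1 →
      Metric.closedBall (0 : EuclideanSpace ℝ (Fin 3)) 1 :=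
    inclusion Metric.sphere_subset_closedBall
  have hi : Continuous i := continuous_inclusion _
  have hneg : ∀ v, ballToOrthoPairs (i (-v)) = ballToOrthoPairs (i v) := fun v =>
    Subtype.ext (ballRotation_neg (mem_sphere_zero_iff_norm.1 v.2))
  have : PreconnectedSpace (Metric.sphere (0 : EuclideanSpace ℝ (Fin 3)) 1) :=
    isPreconnected_iff_preconnectedSpace.1 (isPreconnected_sphere (by
      rw [← Module.finrank_eq_rank]; simp) _ _)
  have hd : Continuous fun v => g (i (-v)) - g (i v) :=
    (hg.comp (hi.comp continuous_neg)).sub (hg.comp hi)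
  have hsym : ∀ v, g (i (-v)) = g (i v) := by
    intro v
    have h1 := congrFun (eq_of_exp_comp_eq hd (continuous_const (y := g (i (-v)) - g (i v)))
      (fun w => by simp [Complex.exp_sub, hgf, hneg, div_self (h0 _)]) (x₀ := v) rfl) (-v)
    simp only [neg_neg] at h1
    linear_combination -h1 / 2
  have hq : IsQuotientMap ballToOrthoPairs :=
    continuous_ballToOrthoPairs.isClosedMap.isQuotientMap continuous_ballToOrthoPairs
      surjective_ballToOrthoPairs
  have hconst : ∀ v w, ballToOrthoPairs v = ballToOrthoPairs w → g v = g w := by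
    intro v w hvw
    have hv := v.2
    have hw := w.2
    rw [mem_closedBall_zero_iff] at hv hw
    rcases eq_or_antipodal_of_ballRotation_eq hv hw (congrArg Subtype.val hvw) with h | ⟨h, h'⟩
    · rw [Subtype.ext h]
    · have e1 : v = i ⟨v, by simpa using h⟩ := rfl
      have e2 : w = i (-⟨v, by simpa using h⟩) := Subtype.ext h'
      rw [e2, hsym, ← e1]
  refine ⟨fun z => g (surjective_ballToOrthoPairs z).choose, ?_, ?_⟩
  · rw [hq.continuous_iff]
    refine hg.congr fun v => ?_
    exact hconst _ _ (surjective_ballToOrthoPairs (ballToOrthoPairs v)).choose_spec.symm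
  · intro z
    rw [hgf, Function.comp_apply, (surjective_ballToOrthoPairs z).choose_spec]

/-! ### Bivectors over `ℝ[ω]` and frames of the space forms -/

/-- The ring `ℝ[ω]` with `ω² = κ`: split-complex numbers, dual numbers or complex numbers. -/
abbrev Scalar (κ : SignType) : Type := QuadraticAlgebra ℝ (κ : ℝ) 0

/-- Bivectors of `ℝ⁴`, in the coordinates of `wedge`, as vectors with three coordinates in
`ℝ[ω]`. -/
def dual (κ : SignType) (w : Fin 6 → ℝ) : Fin 3 → Scalar κ :=
  ![⟨w 0, w 3⟩, ⟨w 1, w 4⟩, ⟨w 2, w 5⟩]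

lemma dual_dotProduct {κ : SignType} (w z : Fin 6 → ℝ) (r : Scalar κ) :
    dual κ w ⬝ᵥ dual κ z = r ↔
      w 0 * z 0 + w 1 * z 1 + w 2 * z 2 + κ * (w 3 * z 3 + w 4 * z 4 + w 5 * z 5) = r.re ∧
      w 0 * z 3 + w 1 * z 4 + w 2 * z 5 + (w 3 * z 0 + w 4 * z 1 + w 5 * z 2) = r.im := by
  rw [QuadraticAlgebra.ext_iff]
  simp only [dual, dotProduct, Fin.sum_univ_three, Matrix.cons_val, QuadraticAlgebra.re_add,
    QuadraticAlgebra.im_add, QuadraticAlgebra.re_mul, QuadraticAlgebra.im_mul]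
  refine and_congr ?_ ?_ <;> ring_nf

/-- Multiplication of bivectors by `ω`; for `κ = ± 1` this is, up to the factor `κ`, the Hodge star
operator. -/
def mulOmega (κ : SignType) (w : Fin 6 → ℝ) : Fin 6 → ℝ :=
  ![κ * w 3, κ * w 4, κ * w 5, w 0, w 1, w 2]

lemma dualForm_comm (κ : SignType) (x y : Fin 4 → ℝ) : dualForm κ x y = dualForm κ y x := by
  simp only [dualForm]; ring

lemma form_comm (κ : SignType) (x y : Fin 4 → ℝ) : form κ x y = form κ y x := by
  simp only [form]; ring

lemma zero_coord_of_tangent {p x : Fin 4 → ℝ} (hp : p ∈ spaceForm 0) (hx : x ∈ tangentPlane 0 p) :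
    p 0 = 1 ∧ x 0 = 0 := by
  have h := hp.2 (by decide)
  have h1 := hp.1
  simp [tangentPlane, dualForm] at h1 hx
  have hx := hx.resolve_left h.ne'
  exact ⟨by nlinarith, hx⟩

/-- For `κ = 0` this holds because tangent vectors have zeroth coordinate `0`. -/
lemma dualForm_of_tangent {κ : SignType} {p x y : Fin 4 → ℝ} (hp : p ∈ spaceForm κ)
    (hx : x ∈ tangentPlane κ p) : dualForm κ x y = κ * form κ x y := by
  rcases κ.trichotomy with rfl | rfl | rfl
  · simp [dualForm, form]; ring
  · simp [dualForm, (zero_coord_of_tangent hp hx).2]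
  · simp [dualForm, form]

lemma form_self_nonneg {κ : SignType} {p z : Fin 4 → ℝ} (hp : p ∈ spaceForm κ)
    (hz : z ∈ tangentPlane κ p) : 0 ≤ form κ z z := by
  rcases κ.trichotomy with rfl | rfl | rfl
  · have h1 := hp.1
    simp only [tangentPlane, mem_ofPred_eq, dualForm, form] at *
    simp at *
    have e3 : p 0 * z 0 = p 1 * z 1 + p 2 * z 2 + p 3 * z 3 := by linarith
    have e4 : (p 0 * z 0) ^ 2
        ≤ (p 1 ^ 2 + p 2 ^ 2 + p 3 ^ 2) * (z 1 ^ 2 + z 2 ^ 2 + z 3 ^ 2) := by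
      rw [e3]
      nlinarith [sq_nonneg (p 1 * z 2 - p 2 * z 1), sq_nonneg (p 1 * z 3 - p 3 * z 1),
        sq_nonneg (p 2 * z 3 - p 3 * z 2)]
    have e5 : p 1 ^ 2 + p 2 ^ 2 + p 3 ^ 2 = p 0 ^ 2 - 1 := by linarith
    rw [e5] at e4
    by_contra! hc
    nlinarith [sq_nonneg (p 0), sq_nonneg (z 1), sq_nonneg (z 2), sq_nonneg (z 3),
      sq_nonneg (p 1), sq_nonneg (p 2), sq_nonneg (p 3)]
  · simp only [form, SignType.coe_zero, zero_mul, zero_add]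
    nlinarith [sq_nonneg (z 1), sq_nonneg (z 2), sq_nonneg (z 3)]
  · simp only [form, SignType.coe_one, one_mul]
    nlinarith [sq_nonneg (z 0), sq_nonneg (z 1), sq_nonneg (z 2), sq_nonneg (z 3)]

/-- The bilinear form over `ℝ[ω]` of two tangent bivectors at `p` is the metric. -/
lemma dual_wedge_dotProduct {κ : SignType} {p x y : Fin 4 → ℝ} (hp : p ∈ spaceForm κ)
    (hx : x ∈ tangentPlane κ p) (hy : y ∈ tangentPlane κ p) :
    dual κ (wedge p x) ⬝ᵥ dual κ (wedge p y) = ⟨form κ x y, 0⟩ := by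
  rw [dual_dotProduct]
  constructor
  · have h1 := hp.1
    rcases κ.trichotomy with rfl | rfl | rfl
    · simp [tangentPlane, dualForm, form, wedge] at *
      linear_combination (-(x 0 * y 0) + (x 1 * y 1 + x 2 * y 2 + x 3 * y 3)) * h1
        + (p 0 * x 0 - (p 1 * x 1 + p 2 * x 2 + p 3 * x 3)) * hy
    · obtain ⟨p0, x0⟩ := zero_coord_of_tangent hp hx
      obtain ⟨-, y0⟩ := zero_coord_of_tangent hp hy
      simp [form, wedge, p0, x0, y0]
    · simp [tangentPlane, dualForm, form, wedge] at *
      linear_combination (x 0 * y 0 + (x 1 * y 1 + x 2 * y 2 + x 3 * y 3)) * h1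
        - (p 0 * x 0 + (p 1 * x 1 + p 2 * x 2 + p 3 * x 3)) * hy
  · simp only [wedge, Matrix.cons_val]
    ring

/-- The cross product in `T_p M_κ`, by an explicit formula: the vector `w` with
`⟨w, z⟩_κ = det (p, x, y, z)` for all `z ∈ T_p M_κ`. -/
def cross (κ : SignType) (p x y : Fin 4 → ℝ) : Fin 4 → ℝ :=
  ![-κ * (p 1 * (x 2 * y 3 - x 3 * y 2) + p 2 * (x 3 * y 1 - x 1 * y 3)
      + p 3 * (x 1 * y 2 - x 2 * y 1)),
    p 0 * (x 2 * y 3 - x 3 * y 2) - x 0 * (p 2 * y 3 - p 3 * y 2) + y 0 * (p 2 * x 3 - p 3 * x 2),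
    p 0 * (x 3 * y 1 - x 1 * y 3) - x 0 * (p 3 * y 1 - p 1 * y 3) + y 0 * (p 3 * x 1 - p 1 * x 3),
    p 0 * (x 1 * y 2 - x 2 * y 1) - x 0 * (p 1 * y 2 - p 2 * y 1) + y 0 * (p 1 * x 2 - p 2 * x 1)]

lemma det_four (p x y z : Fin 4 → ℝ) : (Matrix.of ![p, x, y, z]).det =
    -(p 1 * (x 2 * y 3 - x 3 * y 2) + p 2 * (x 3 * y 1 - x 1 * y 3)
      + p 3 * (x 1 * y 2 - x 2 * y 1)) * z 0
    + (p 0 * (x 2 * y 3 - x 3 * y 2) - x 0 * (p 2 * y 3 - p 3 * y 2)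
      + y 0 * (p 2 * x 3 - p 3 * x 2)) * z 1
    + (p 0 * (x 3 * y 1 - x 1 * y 3) - x 0 * (p 3 * y 1 - p 1 * y 3)
      + y 0 * (p 3 * x 1 - p 1 * x 3)) * z 2
    + (p 0 * (x 1 * y 2 - x 2 * y 1) - x 0 * (p 1 * y 2 - p 2 * y 1)
      + y 0 * (p 1 * x 2 - p 2 * x 1)) * z 3 := by
  simp [Matrix.det_succ_row_zero, Fin.sum_univ_succ, Fin.succAbove]
  ring

lemma form_cross {κ : SignType} {p x y z : Fin 4 → ℝ} (hp : p ∈ spaceForm κ)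
    (hz : z ∈ tangentPlane κ p) : form κ (cross κ p x y) z = (Matrix.of ![p, x, y, z]).det := by
  rw [det_four]
  rcases κ.trichotomy with rfl | rfl | rfl
  · simp [form, cross]; ring
  · simp [form, cross, (zero_coord_of_tangent hp hz).2]
  · simp [form, cross]; ring

lemma cross_mem (κ : SignType) (p x y : Fin 4 → ℝ) : cross κ p x y ∈ tangentPlane κ p := by
  simp only [tangentPlane, mem_ofPred_eq, dualForm, cross, Matrix.cons_val]
  ring

lemma form_cross_self {κ : SignType} {p x y : Fin 4 → ℝ} (hp : p ∈ spaceForm κ)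
    (hx : x ∈ tangentPlane κ p) (hy : y ∈ tangentPlane κ p) :
    form κ (cross κ p x y) (cross κ p x y) = form κ x x * form κ y y - form κ x y ^ 2 := by
  have h1 := hp.1
  rcases κ.trichotomy with rfl | rfl | rfl
  · have hx : form (-1) p x = 0 := by simp [tangentPlane, dualForm, form] at *; linarith
    have hy : form (-1) p y = 0 := by simp [tangentPlane, dualForm, form] at *; linarith
    have hpp : form (-1) p p = -1 := by simp [dualForm, form] at *; linarith
    have key : form (-1) (cross (-1) p x y) (cross (-1) p x y) =
        -(form (-1) p p * (form (-1) x x * form (-1) y y - form (-1) x y ^ 2)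
        - form (-1) p x * (form (-1) p x * form (-1) y y - form (-1) x y * form (-1) p y)
        + form (-1) p y * (form (-1) p x * form (-1) x y - form (-1) x x * form (-1) p y)) := by
      simp [form, cross]; ring
    rw [key, hx, hy, hpp]; ring
  · obtain ⟨p0, x0⟩ := zero_coord_of_tangent hp hx
    obtain ⟨-, y0⟩ := zero_coord_of_tangent hp hy
    simp [form, cross, p0, x0, y0]; ring
  · have hx : form 1 p x = 0 := by simp [tangentPlane, dualForm, form] at *; linarith
    have hy : form 1 p y = 0 := by simp [tangentPlane, dualForm, form] at *; linarith
    have hpp : form 1 p p = 1 := by simp [dualForm, form] at *; linarith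
    have key : form 1 (cross 1 p x y) (cross 1 p x y) =
        (form 1 p p * (form 1 x x * form 1 y y - form 1 x y ^ 2)
        - form 1 p x * (form 1 p x * form 1 y y - form 1 x y * form 1 p y)
        + form 1 p y * (form 1 p x * form 1 x y - form 1 x x * form 1 p y)) := by
      simp [form, cross]; ring
    rw [key, hx, hy, hpp]; ring

/-- `x ∧ y = ω (p ∧ (x × y))` for tangent vectors `x, y` at `p`. -/
lemma wedge_eq_mulOmega {κ : SignType} {p x y : Fin 4 → ℝ} (hp : p ∈ spaceForm κ)
    (hx : x ∈ tangentPlane κ p) (hy : y ∈ tangentPlane κ p) :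
    wedge x y = mulOmega κ (wedge p (cross κ p x y)) := by
  have h1 := hp.1
  simp only [tangentPlane, mem_ofPred_eq, dualForm] at h1 hx hy
  ext i
  fin_cases i <;> simp only [wedge, mulOmega, cross, Matrix.cons_val, Fin.zero_eta, Fin.mk_one,
    Fin.reduceFinMk]
  · linear_combination (x 1 * y 0 - x 0 * y 1) * h1 + (p 0 * y 1 - p 1 * y 0) * hx
      + (p 1 * x 0 - p 0 * x 1) * hy
  · linear_combination (x 2 * y 0 - x 0 * y 2) * h1 + (p 0 * y 2 - p 2 * y 0) * hx
      + (p 2 * x 0 - p 0 * x 2) * hy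
  · linear_combination (x 3 * y 0 - x 0 * y 3) * h1 + (p 0 * y 3 - p 3 * y 0) * hx
      + (p 3 * x 0 - p 0 * x 3) * hy
  · linear_combination (x 3 * y 2 - x 2 * y 3) * h1 + (p 2 * y 3 - p 3 * y 2) * hx
      + (p 3 * x 2 - p 2 * x 3) * hy
  · linear_combination (x 1 * y 3 - x 3 * y 1) * h1 + (p 3 * y 1 - p 1 * y 3) * hx
      + (p 1 * x 3 - p 3 * x 1) * hy
  · linear_combination (x 2 * y 1 - x 1 * y 2) * h1 + (p 1 * y 2 - p 2 * y 1) * hx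
      + (p 2 * x 1 - p 1 * x 2) * hy

/-- Orthonormal vectors in `T_p M_κ`. -/
structure IsOrthonormalPair (κ : SignType) (p x y : Fin 4 → ℝ) : Prop where
  left_mem : x ∈ tangentPlane κ p
  right_mem : y ∈ tangentPlane κ p
  left_unit : form κ x x = 1
  right_unit : form κ y y = 1
  orthogonal : form κ x y = 0

lemma det_cross {κ : SignType} {p x y : Fin 4 → ℝ} (hp : p ∈ spaceForm κ)
    (h : IsOrthonormalPair κ p x y) : (Matrix.of ![p, x, y, cross κ p x y]).det = 1 := by
  rw [← form_cross hp (cross_mem κ p x y), form_cross_self hp h.left_mem h.right_mem,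
    h.left_unit, h.right_unit, h.orthogonal]
  norm_num

lemma isCross_cross {κ : SignType} {p x y : Fin 4 → ℝ} (hp : p ∈ spaceForm κ)
    (h : IsOrthonormalPair κ p x y) : IsCross κ p x y (cross κ p x y) := by
  refine ⟨cross_mem κ p x y, ?_, ?_, ?_, by rw [det_cross hp h]; exact one_pos⟩
  · rw [form_cross_self hp h.left_mem h.right_mem, h.left_unit, h.right_unit, h.orthogonal]
    norm_num
  · rw [form_comm, form_cross hp h.left_mem, det_four]; ring
  · rw [form_comm, form_cross hp h.right_mem, det_four]; ring

/-- For `κ = ± 1` this is read off from the Gram matrix of `p, x, y, z`; for `κ = 0` the vector `p`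
is first replaced by `(1, 0, 0, 0)`, as `x, y, z` have zeroth coordinate `0`. -/
lemma det_sq_of_isCross {κ : SignType} {p x y z : Fin 4 → ℝ} (hp : p ∈ spaceForm κ)
    (h : IsOrthonormalPair κ p x y) (hz : IsCross κ p x y z) :
    (Matrix.of ![p, x, y, z]).det ^ 2 = 1 := by
  obtain ⟨hzt, hzz, hxz, hyz, -⟩ := hz
  have hxx := h.left_unit
  have hyy := h.right_unit
  have hxy := h.orthogonal
  have hx := h.left_mem
  have hy := h.right_mem
  have h1 := hp.1
  rcases κ.trichotomy with rfl | rfl | rfl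
  · have key : (Matrix.of ![p, x, y, z]) * Matrix.diagonal ![-1, 1, 1, 1]
        * (Matrix.of ![p, x, y, z]).transpose = Matrix.diagonal ![-1, 1, 1, 1] := by
      simp [tangentPlane, dualForm, form] at hzt hzz hxz hyz hxx hyy hxy hx hy h1
      ext i j
      simp only [Matrix.mul_apply, Matrix.transpose_apply, Matrix.of_apply,
        Fin.sum_univ_four]
      fin_cases i <;> fin_cases j <;> simp <;> linarith
    have := congrArg Matrix.det key
    rw [Matrix.det_mul, Matrix.det_mul, Matrix.det_transpose, Matrix.det_diagonal] at this
    simp [Fin.prod_univ_four] at this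
    rw [sq]; linarith
  · obtain ⟨p0, x0⟩ := zero_coord_of_tangent hp hx
    obtain ⟨-, y0⟩ := zero_coord_of_tangent hp hy
    obtain ⟨-, z0⟩ := zero_coord_of_tangent hp hzt
    have key : (Matrix.of ![![1, 0, 0, 0], x, y, z])
        * (Matrix.of ![![1, 0, 0, 0], x, y, z]).transpose = 1 := by
      simp [form, x0, y0, z0] at hzz hxz hyz hxx hyy hxy
      ext i j
      simp only [Matrix.mul_apply, Matrix.transpose_apply, Matrix.of_apply, Fin.sum_univ_four]
      fin_cases i <;> fin_cases j <;> simp [x0, y0, z0] <;> linarith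
    have := congrArg Matrix.det key
    rw [Matrix.det_mul, Matrix.det_transpose, Matrix.det_one] at this
    rw [sq, ← this, det_four, det_four]
    simp [p0, x0, y0, z0]
  · have key : (Matrix.of ![p, x, y, z]) * (Matrix.of ![p, x, y, z]).transpose = 1 := by
      simp [tangentPlane, dualForm, form] at hzt hzz hxz hyz hxx hyy hxy hx hy h1
      ext i j
      simp only [Matrix.mul_apply, Matrix.transpose_apply, Matrix.of_apply, Fin.sum_univ_four]
      fin_cases i <;> fin_cases j <;> simp <;> linarith
    have := congrArg Matrix.det key
    rw [Matrix.det_mul, Matrix.det_transpose, Matrix.det_one] at this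
    rw [sq, this]

lemma eq_cross_of_isCross {κ : SignType} {p x y z : Fin 4 → ℝ} (hp : p ∈ spaceForm κ)
    (h : IsOrthonormalPair κ p x y) (hz : IsCross κ p x y z) : z = cross κ p x y := by
  have hd : (Matrix.of ![p, x, y, z]).det = 1 := by
    nlinarith [det_sq_of_isCross hp h hz, hz.2.2.2.2]
  rw [← form_cross hp hz.1] at hd
  have hc := isCross_cross hp h
  rw [← sub_eq_zero]
  refine eq_zero_of_form_self hp (z := z - cross κ p x y) ?_ ?_
  · have e1 := hz.1
    have e2 := hc.1
    simp only [tangentPlane, mem_ofPred_eq, dualForm, Pi.sub_apply] at *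
    linear_combination e1 - e2
  · have e1 := hz.2.1
    have e2 := hc.2.1
    generalize cross κ p x y = c at *
    simp only [form, Pi.sub_apply] at *
    linear_combination e1 + e2 - 2 * hd

lemma isCross_rotate {κ : SignType} {p x y : Fin 4 → ℝ} (hp : p ∈ spaceForm κ)
    (h : IsOrthonormalPair κ p x y) : IsCross κ p (cross κ p x y) x y := by
  obtain ⟨h1, h2, h3, h4, h5⟩ := isCross_cross hp h
  refine ⟨h.right_mem, h.right_unit, by rw [form_comm]; exact h4, h.orthogonal, ?_⟩
  rw [det_four] at h5 ⊢
  linarith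

/-! ### Orthonormal pairs over `ℝ[ω]` -/

lemma eq_sum_of_orthonormal {R : Type*} [CommRing R] {a b c : Fin 3 → R} (haa : a ⬝ᵥ a = 1)
    (hbb : b ⬝ᵥ b = 1) (hcc : c ⬝ᵥ c = 1) (hab : a ⬝ᵥ b = 0) (hac : a ⬝ᵥ c = 0)
    (hbc : b ⬝ᵥ c = 0) (v : Fin 3 → R) :
    v = (a ⬝ᵥ v) • a + (b ⬝ᵥ v) • b + (c ⬝ᵥ v) • c := by
  have h : Matrix.of ![a, b, c] * (Matrix.of ![a, b, c]).transpose = 1 := by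
    ext i j
    have hba := dotProduct_comm b a
    have hca := dotProduct_comm c a
    have hcb := dotProduct_comm c b
    change ![a, b, c] i ⬝ᵥ ![a, b, c] j = _
    fin_cases i <;> fin_cases j <;> simp_all
  have h1 : (Matrix.of ![a, b, c]).transpose.mulVec ((Matrix.of ![a, b, c]).mulVec v) = v := by
    rw [Matrix.mulVec_mulVec, mul_eq_one_comm.1 h, Matrix.one_mulVec]
  ext i
  have h2 := congrFun h1 i
  simp only [Matrix.mulVec, dotProduct, Fin.sum_univ_three, Matrix.transpose_apply,
    Matrix.of_apply, Matrix.cons_val] at h2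
  simp only [dotProduct, Fin.sum_univ_three, Pi.add_apply, Pi.smul_apply, smul_eq_mul]
  linear_combination -h2

lemma dual_injective (κ : SignType) : Function.Injective (dual κ) := by
  intro w z h
  have h0 := congrFun h 0
  have h1 := congrFun h 1
  have h2 := congrFun h 2
  simp only [dual, Matrix.cons_val, QuadraticAlgebra.mk.injEq] at h0 h1 h2
  ext i
  fin_cases i
  exacts [h0.1, h1.1, h2.1, h0.2, h1.2, h2.2]

/-- Multiplication of bivectors by elements of `ℝ[ω]`. -/
def scalarMul {κ : SignType} (r : Scalar κ) (w : Fin 6 → ℝ) : Fin 6 → ℝ :=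
  r.re • w + r.im • mulOmega κ w

lemma dual_scalarMul {κ : SignType} (r : Scalar κ) (w : Fin 6 → ℝ) :
    dual κ (scalarMul r w) = r • dual κ w := by
  ext i <;> fin_cases i <;> simp [dual, scalarMul, mulOmega] <;> ring

lemma dual_add (κ : SignType) (w z : Fin 6 → ℝ) : dual κ (w + z) = dual κ w + dual κ z := by
  ext i <;> fin_cases i <;> simp [dual]

lemma scalarMul_scalarMul {κ : SignType} (r s : Scalar κ) (w : Fin 6 → ℝ) :
    scalarMul r (scalarMul s w) = scalarMul (r * s) w := by
  apply dual_injective κ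
  rw [dual_scalarMul, dual_scalarMul, dual_scalarMul, smul_smul]

lemma scalarMul_one {κ : SignType} (w : Fin 6 → ℝ) : scalarMul (1 : Scalar κ) w = w := by
  apply dual_injective κ
  rw [dual_scalarMul, one_smul]

lemma continuous_scalarMul {κ : SignType} (r : Scalar κ) : Continuous (scalarMul r) := by
  unfold scalarMul mulOmega
  fun_prop

/-- Pairs of bivectors that are orthonormal over `ℝ[ω]`, as a model of `SO(3, ℝ[ω])`. -/
def dualPairs (κ : SignType) : Set ((Fin 6 → ℝ) × (Fin 6 → ℝ)) :=
  {z | dual κ z.1 ⬝ᵥ dual κ z.1 = 1 ∧ dual κ z.2 ⬝ᵥ dual κ z.2 = 1 ∧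
    dual κ z.1 ⬝ᵥ dual κ z.2 = 0}

lemma mem_quadric_iff {κ : SignType} (w : Fin 6 → ℝ) :
    w ∈ quadric κ ↔ dual κ w ⬝ᵥ dual κ w = 1 := by
  rw [dual_dotProduct, quadric, mem_ofPred_eq, pluckerNorm, QuadraticAlgebra.re_one,
    QuadraticAlgebra.im_one]
  constructor
  · rintro ⟨h1, h2⟩
    exact ⟨by linarith, by linarith⟩
  · rintro ⟨h1, h2⟩
    exact ⟨by linarith, by linarith⟩

lemma wedge_mem_dualPairs {κ : SignType} {p x y : Fin 4 → ℝ} (hp : p ∈ spaceForm κ)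
    (h : IsOrthonormalPair κ p x y) : (wedge p x, wedge p y) ∈ dualPairs κ := by
  refine ⟨?_, ?_, ?_⟩
  · rw [dual_wedge_dotProduct hp h.left_mem h.left_mem, h.left_unit]; rfl
  · rw [dual_wedge_dotProduct hp h.right_mem h.right_mem, h.right_unit]; rfl
  · rw [dual_wedge_dotProduct hp h.left_mem h.right_mem, h.orthogonal]; rfl

lemma exists_isOrthonormalPair {κ : SignType} {p u : Fin 4 → ℝ} (hp : p ∈ spaceForm κ)
    (hu : u ∈ tangentPlane κ p) (h : form κ u u = 1) : ∃ b, IsOrthonormalPair κ p u b := by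
  let L : (Fin 4 → ℝ) →ₗ[ℝ] (Fin 2 → ℝ) :=
    { toFun := fun z => ![dualForm κ p z, form κ u z]
      map_add' := by intro x y; ext i; fin_cases i <;> simp [dualForm, form] <;> ring
      map_smul' := by intro r x; ext i; fin_cases i <;> simp [dualForm, form] <;> ring }
  obtain ⟨z, hz, hz0⟩ := (Submodule.ne_bot_iff _).1
    (LinearMap.ker_ne_bot_of_finrank_lt (f := L) (by simp))
  have hz1 : z ∈ tangentPlane κ p := congrFun (LinearMap.mem_ker.1 hz) 0
  have hz2 : form κ u z = 0 := congrFun (LinearMap.mem_ker.1 hz) 1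
  have hpos : 0 < form κ z z := lt_of_le_of_ne (form_self_nonneg hp hz1) fun h0 =>
    hz0 (eq_zero_of_form_self hp hz1 h0.symm)
  have hs := Real.sq_sqrt hpos.le
  have hs0 := (Real.sqrt_pos.2 hpos).ne'
  refine ⟨(√(form κ z z))⁻¹ • z, hu, ?_, h, ?_, ?_⟩
  · simp only [tangentPlane, mem_ofPred_eq, dualForm, Pi.smul_apply, smul_eq_mul] at *
    linear_combination (√(form κ z z))⁻¹ * hz1
  · have : form κ ((√(form κ z z))⁻¹ • z) ((√(form κ z z))⁻¹ • z)
        = ((√(form κ z z))⁻¹) ^ 2 * form κ z z := by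
      simp only [form, Pi.smul_apply, smul_eq_mul]; ring
    rw [this, inv_pow, hs, inv_mul_cancel₀ hpos.ne']
  · have : form κ u ((√(form κ z z))⁻¹ • z) = (√(form κ z z))⁻¹ * form κ u z := by
      simp only [form, Pi.smul_apply, smul_eq_mul]; ring
    rw [this, hz2, mul_zero]

/-- For an orthonormal pair `u, b` at `p`, the bivectors `p ∧ u`, `p ∧ b` and `p ∧ (u × b)` form an
orthonormal basis over `ℝ[ω]`. -/
lemma eq_sum_dual_wedge {κ : SignType} {p u b : Fin 4 → ℝ} (hp : p ∈ spaceForm κ)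
    (h : IsOrthonormalPair κ p u b) (v : Fin 3 → Scalar κ) :
    v = (dual κ (wedge p u) ⬝ᵥ v) • dual κ (wedge p u)
      + (dual κ (wedge p b) ⬝ᵥ v) • dual κ (wedge p b)
      + (dual κ (wedge p (cross κ p u b)) ⬝ᵥ v) • dual κ (wedge p (cross κ p u b)) := by
  obtain ⟨h1, h2, h3, h4, -⟩ := isCross_cross hp h
  refine eq_sum_of_orthonormal ?_ ?_ ?_ ?_ ?_ ?_ v
  · rw [dual_wedge_dotProduct hp h.left_mem h.left_mem, h.left_unit]; rfl
  · rw [dual_wedge_dotProduct hp h.right_mem h.right_mem, h.right_unit]; rfl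
  · rw [dual_wedge_dotProduct hp h1 h1, h2]; rfl
  · rw [dual_wedge_dotProduct hp h.left_mem h.right_mem, h.orthogonal]; rfl
  · rw [dual_wedge_dotProduct hp h.left_mem h1, h3]; rfl
  · rw [dual_wedge_dotProduct hp h.right_mem h1, h4]; rfl

/-- A point of the unit circle over `ℝ[ω]` is `(e₁, e₂) c + (-e₂, e₁) s ω` with `(e₁, e₂)` in the
real unit circle and `c = cos_κ t`, `s = sin_κ t`. -/
lemma exists_of_sq_add_sq_eq_one {κ : SignType} {X Y : Scalar κ} (h : X * X + Y * Y = 1) :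
    ∃ e₁ e₂ t : ℝ, e₁ ^ 2 + e₂ ^ 2 = 1 ∧ X = ⟨cosK κ t * e₁, -(sinK κ t * e₂)⟩ ∧
      Y = ⟨cosK κ t * e₂, sinK κ t * e₁⟩ := by
  obtain ⟨x, x'⟩ := X
  obtain ⟨y, y'⟩ := Y
  have h1 : x ^ 2 + y ^ 2 + κ * (x' ^ 2 + y' ^ 2) = 1 := by
    have := congrArg QuadraticAlgebra.re h
    simp [QuadraticAlgebra.re_one] at this
    linear_combination this
  have h2 : x * x' + y * y' = 0 := by
    have := congrArg QuadraticAlgebra.im h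
    simp [QuadraticAlgebra.im_one] at this
    linear_combination this / 2
  -- it suffices to find the direction `(e₁, e₂)` of `(x, y)`
  suffices hs : ∃ e₁ e₂ c s : ℝ, e₁ ^ 2 + e₂ ^ 2 = 1 ∧ x = c * e₁ ∧ y = c * e₂ ∧ x' = -(s * e₂) ∧
      y' = s * e₁ ∧ (κ ≠ 1 → 0 < c) by
    obtain ⟨e₁, e₂, c, s, he, rfl, rfl, rfl, rfl, hc⟩ := hs
    obtain ⟨t, rfl, rfl⟩ := exists_cosK_sinK κ (a := c) (b := s)
      (by linear_combination h1 - (c ^ 2 + κ * s ^ 2) * he) hc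
    exact ⟨e₁, e₂, t, he, rfl, rfl⟩
  by_cases h0 : x ^ 2 + y ^ 2 = 0
  · have hx : x = 0 := by nlinarith [sq_nonneg x, sq_nonneg y]
    have hy : y = 0 := by nlinarith [sq_nonneg x, sq_nonneg y]
    have hκ : κ = 1 := by
      rcases κ.trichotomy with rfl | rfl | rfl
      · simp [hx, hy] at h1; nlinarith [sq_nonneg x', sq_nonneg y']
      · simp [hx, hy] at h1
      · rfl
    subst hκ
    refine ⟨y', -x', 0, 1, ?_, by simp [hx], by simp [hy], by simp, by simp, fun h => absurd rfl h⟩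
    simp [hx, hy] at h1
    linarith
  · have hr : 0 < x ^ 2 + y ^ 2 := lt_of_le_of_ne (by positivity) (Ne.symm h0)
    obtain ⟨c, hc0, hc⟩ : ∃ c : ℝ, 0 < c ∧ c ^ 2 = x ^ 2 + y ^ 2 :=
      ⟨_, Real.sqrt_pos.2 hr, Real.sq_sqrt hr.le⟩
    refine ⟨x / c, y / c, c, (x * y' - y * x') / c, ?_, ?_, ?_, ?_, ?_, fun _ => hc0⟩
    · field_simp; linarith
    · field_simp
    · field_simp
    · field_simp; linear_combination x' * hc + x * h2
    · field_simp; linear_combination y' * hc + y * h2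

/-- Every orthonormal pair over `ℝ[ω]` comes from a frame of `M_κ`: given a frame along the geodesic
with the first bivector, the other vector of the pair is reached by a rotation of the frame about
the geodesic and a translation along it. -/
lemma exists_frame_of_mem_dualPairs {κ : SignType} {w y : Fin 6 → ℝ} (h : (w, y) ∈ dualPairs κ) :
    ∃ p u b : Fin 4 → ℝ, p ∈ spaceForm κ ∧ IsOrthonormalPair κ p u b ∧ wedge p u = w ∧
      wedge p b = y := by
  obtain ⟨hww, hyy, hwy⟩ := h
  simp only at hww hyy hwy
  obtain ⟨p, u, hp, hu, huu, rfl⟩ := exists_of_mem_quadric ((mem_quadric_iff w).2 hww)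
  obtain ⟨b, hb⟩ := exists_isOrthonormalPair hp hu huu
  set a := cross κ p u b with ha
  obtain ⟨ha1, ha2, ha3, ha4, -⟩ := isCross_cross hp hb
  rw [← ha] at ha1 ha2 ha3 ha4
  have hexp := eq_sum_dual_wedge hp hb (dual κ y)
  rw [hwy, zero_smul, zero_add, ← ha] at hexp
  set X := dual κ (wedge p b) ⬝ᵥ dual κ y with hX
  set Y := dual κ (wedge p a) ⬝ᵥ dual κ y with hY
  have hXY : X * X + Y * Y = 1 := by
    rw [← hyy]
    conv_rhs => rw [hexp]
    rw [add_dotProduct, smul_dotProduct, smul_dotProduct, ← hexp, ← hX, ← hY, smul_eq_mul,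
      smul_eq_mul]
  obtain ⟨e₁, e₂, t, he, hXe, hYe⟩ := exists_of_sq_add_sq_eq_one hXY
  obtain ⟨σ0, σ1⟩ := geodesicOf_zero hp hu huu
  set σ := geodesicOf hp hu huu
  obtain ⟨f1, f2⟩ := σ.formula t
  rw [σ0, σ1] at f1 f2
  have hub : wedge u b = mulOmega κ (wedge p a) := wedge_eq_mulOmega hp hu hb.right_mem
  have hua : wedge u a = -mulOmega κ (wedge p b) := by
    have h1 := wedge_eq_mulOmega hp ha1 hu
    have hau : IsOrthonormalPair κ p a u := ⟨ha1, hu, ha2, huu, by rw [form_comm]; exact ha3⟩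
    rw [← eq_cross_of_isCross hp hau (isCross_rotate hp hb)] at h1
    rw [← h1]
    ext i; fin_cases i <;> simp [wedge] <;> ring
  have hdu : ∀ z, dualForm κ u z = κ * form κ u z := fun z => dualForm_of_tangent hp hu
  have hpb : dualForm κ p b = 0 := hb.right_mem
  have hpa : dualForm κ p a = 0 := ha1
  have hbp := dualForm_of_tangent hp hb.right_mem (y := p)
  have hap := dualForm_of_tangent hp ha1 (y := p)
  have hub0 := hb.orthogonal
  have hbb := hb.right_unit
  refine ⟨σ.curve t, deriv σ.curve t, e₁ • b + e₂ • a, σ.mem t,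
    ⟨σ.geodesic.tangent t, ?_, σ.unit_speed t, ?_, ?_⟩, ?_, ?_⟩
  · have h1 := hdu b
    have h2 := hdu a
    rw [hub0] at h1
    rw [ha3] at h2
    rw [f1]
    simp only [tangentPlane, mem_ofPred_eq, dualForm, Pi.add_apply, Pi.smul_apply,
      smul_eq_mul] at *
    linear_combination cosK κ t * (e₁ * hpb + e₂ * hpa) + sinK κ t * (e₁ * h1 + e₂ * h2)
  · simp only [form, Pi.add_apply, Pi.smul_apply, smul_eq_mul] at *
    linear_combination he + e₁ ^ 2 * hbb + e₂ ^ 2 * ha2 + 2 * e₁ * e₂ * ha4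
  · rw [dualForm_comm, hpb] at hbp
    rw [dualForm_comm, hpa] at hap
    rw [f2]
    simp only [form, Pi.add_apply, Pi.smul_apply, smul_eq_mul] at *
    linear_combination sinK κ t * (e₁ * hbp + e₂ * hap) + cosK κ t * (e₁ * hub0 + e₂ * ha3)
  · rw [σ.wedge_eq, σ0, σ1]
  · apply dual_injective κ
    rw [hexp, hXe, hYe, ← dual_scalarMul, ← dual_scalarMul, ← dual_add]
    congr 1
    have : wedge (σ.curve t) (e₁ • b + e₂ • a) = cosK κ t • (e₁ • wedge p b + e₂ • wedge p a)
        + sinK κ t • (e₁ • wedge u b + e₂ • wedge u a) := by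
      rw [f1]
      ext i; fin_cases i <;> simp [wedge] <;> ring
    rw [this, hub, hua]
    simp only [scalarMul]
    module

/-! ### Continuous logarithms on `SO(3, ℝ[ω])` -/

/-- The homeomorphism `SO(3, ℝ × ℝ) ≅ SO(3) × SO(3)`, for `ℝ[ω] ≅ ℝ × ℝ`. -/
lemma hasContinuousLogs_dualPairs_one : HasContinuousLogs (dualPairs 1) := by
  have hY := hasContinuousLogs_orthoPairs.prod hasContinuousLogs_orthoPairs
  let v : (Fin 6 → ℝ) → Fin 3 → ℝ := fun w => ![w 0 + w 3, w 1 + w 4, w 2 + w 5]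
  let m : (Fin 6 → ℝ) → Fin 3 → ℝ := fun w => ![w 0 - w 3, w 1 - w 4, w 2 - w 5]
  let j : (Fin 3 → ℝ) → (Fin 3 → ℝ) → Fin 6 → ℝ := fun a b =>
    ![(a 0 + b 0) / 2, (a 1 + b 1) / 2, (a 2 + b 2) / 2,
      (a 0 - b 0) / 2, (a 1 - b 1) / 2, (a 2 - b 2) / 2]
  have hv : Continuous v := by fun_prop
  have hm : Continuous m := by fun_prop
  have hj : Continuous fun z : (Fin 3 → ℝ) × (Fin 3 → ℝ) => j z.1 z.2 := by fun_prop
  have hjm : ∀ w, j (v w) (m w) = w := by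
    intro w; ext i; fin_cases i <;> simp [j, v, m]
  have hvdot : ∀ w z r, dual 1 w ⬝ᵥ dual 1 z = r → v w ⬝ᵥ v z = r.re + r.im := by
    intro w z r h
    obtain ⟨h1, h2⟩ := (dual_dotProduct w z r).1 h
    simp [v, dotProduct, Fin.sum_univ_three] at *
    linear_combination h1 + h2
  have hmdot : ∀ w z r, dual 1 w ⬝ᵥ dual 1 z = r → m w ⬝ᵥ m z = r.re - r.im := by
    intro w z r h
    obtain ⟨h1, h2⟩ := (dual_dotProduct w z r).1 h
    simp [m, dotProduct, Fin.sum_univ_three] at *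
    linear_combination h1 - h2
  have hjdot : ∀ a b c d, dual 1 (j a b) ⬝ᵥ dual 1 (j c d)
      = ⟨(a ⬝ᵥ c + b ⬝ᵥ d) / 2, (a ⬝ᵥ c - b ⬝ᵥ d) / 2⟩ := by
    intro a b c d
    rw [dual_dotProduct]
    simp [j, dotProduct, Fin.sum_univ_three]
    constructor <;> ring
  have hr : ∀ z ∈ dualPairs 1, (v z.1, v z.2) ∈ orthoPairs ∧ (m z.1, m z.2) ∈ orthoPairs := by
    rintro z ⟨h1, h2, h3⟩
    refine ⟨⟨?_, ?_, ?_⟩, ⟨?_, ?_, ?_⟩⟩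
    · simpa [QuadraticAlgebra.re_one, QuadraticAlgebra.im_one] using hvdot _ _ _ h1
    · simpa [QuadraticAlgebra.re_one, QuadraticAlgebra.im_one] using hvdot _ _ _ h2
    · simpa using hvdot _ _ _ h3
    · simpa [QuadraticAlgebra.re_one, QuadraticAlgebra.im_one] using hmdot _ _ _ h1
    · simpa [QuadraticAlgebra.re_one, QuadraticAlgebra.im_one] using hmdot _ _ _ h2
    · simpa using hmdot _ _ _ h3
  have hq : ∀ z ∈ orthoPairs, ∀ z' ∈ orthoPairs, (j z.1 z'.1, j z.2 z'.2) ∈ dualPairs 1 := by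
    rintro z ⟨h1, h2, h3⟩ z' ⟨h1', h2', h3'⟩
    refine ⟨?_, ?_, ?_⟩ <;>
      simp [hjdot, h1, h2, h3, h1', h2', h3'] <;> rfl
  refine hY.of_retract
    (q := fun z => ⟨(j z.1.1.1 z.2.1.1, j z.1.1.2 z.2.1.2), hq _ z.1.2 _ z.2.2⟩)
    (r := fun z => (⟨(v z.1.1, v z.1.2), (hr _ z.2).1⟩, ⟨(m z.1.1, m z.1.2), (hr _ z.2).2⟩))
    ?_ ?_ ?_
  · refine Continuous.subtype_mk (Continuous.prodMk ?_ ?_) _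
    · exact hj.comp (f := fun z : orthoPairs × orthoPairs => (z.1.1.1, z.2.1.1)) (by fun_prop)
    · exact hj.comp (f := fun z : orthoPairs × orthoPairs => (z.1.1.2, z.2.1.2)) (by fun_prop)
  · refine Continuous.prodMk (Continuous.subtype_mk ?_ _) (Continuous.subtype_mk ?_ _) <;>
      fun_prop
  · rintro ⟨z, hz⟩
    simp [hjm]

/-- The zeroth coordinate of the point of `M_κ`, for `κ ≤ 0`, whose other coordinates are `p`. -/
noncomputable def height (κ : SignType) (p : Fin 3 → ℝ) : ℝ := √(1 - κ * (p ⬝ᵥ p))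

/-- The bivector `P ∧ A`, for `κ ≤ 0`, where `P` is the point of `M_κ` with the spatial coordinates
`p`, and `A` is the parallel translate of the vector `(0, a)` at the point `(1, 0, 0, 0)` along the
geodesic from there to `P`. -/
noncomputable def boost (κ : SignType) (p a : Fin 3 → ℝ) : Fin 6 → ℝ :=
  let h := height κ p
  let c := κ * (p ⬝ᵥ a) * (1 + h)⁻¹
  ![h * a 0 + c * p 0, h * a 1 + c * p 1, h * a 2 + c * p 2,
    p 1 * a 2 - p 2 * a 1, p 2 * a 0 - p 0 * a 2, p 0 * a 1 - p 1 * a 0]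

/-- The left inverse of `a ↦ boost κ p a`. -/
noncomputable def unboost (κ : SignType) (p : Fin 3 → ℝ) (w : Fin 6 → ℝ) : Fin 3 → ℝ :=
  let h := height κ p
  let c := κ * (p 0 * w 0 + p 1 * w 1 + p 2 * w 2) * (1 + h)⁻¹
  ![h * w 0 + c * p 0 - κ * (p 1 * w 5 - p 2 * w 4),
    h * w 1 + c * p 1 - κ * (p 2 * w 3 - p 0 * w 5),
    h * w 2 + c * p 2 - κ * (p 0 * w 4 - p 1 * w 3)]

lemma continuous_height (κ : SignType) : Continuous (height κ) := by
  unfold height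
  simp only [dotProduct]
  fun_prop

lemma one_add_height_pos (κ : SignType) (p : Fin 3 → ℝ) : 0 < 1 + height κ p :=
  add_pos_of_pos_of_nonneg one_pos (Real.sqrt_nonneg _)

lemma continuous_boost (κ : SignType) :
    Continuous fun z : (Fin 3 → ℝ) × (Fin 3 → ℝ) => boost κ z.1 z.2 := by
  have h := continuous_height κ
  have h' : Continuous fun z : (Fin 3 → ℝ) × (Fin 3 → ℝ) => (1 + height κ z.1)⁻¹ :=
    (continuous_const.add (h.comp continuous_fst)).inv₀ fun z => (one_add_height_pos κ z.1).ne'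
  simp only [boost, dotProduct]
  fun_prop

lemma continuous_unboost (κ : SignType) :
    Continuous fun z : (Fin 3 → ℝ) × (Fin 6 → ℝ) => unboost κ z.1 z.2 := by
  have h := continuous_height κ
  have h' : Continuous fun z : (Fin 3 → ℝ) × (Fin 6 → ℝ) => (1 + height κ z.1)⁻¹ :=
    (continuous_const.add (h.comp continuous_fst)).inv₀ fun z => (one_add_height_pos κ z.1).ne'
  simp only [unboost]
  fun_prop

lemma cast_nonpos {κ : SignType} (hκ : κ ≠ 1) : (κ : ℝ) ≤ 0 := by
  rcases κ.trichotomy with rfl | rfl | rfl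
  · simp
  · simp
  · exact absurd rfl hκ

lemma height_sq {κ : SignType} (hκ : κ ≠ 1) (p : Fin 3 → ℝ) :
    height κ p ^ 2 + κ * (p 0 ^ 2 + p 1 ^ 2 + p 2 ^ 2) = 1 := by
  have h := cast_nonpos hκ
  rw [height, Real.sq_sqrt]
  · simp [dotProduct, Fin.sum_univ_three]; ring
  · have : 0 ≤ p ⬝ᵥ p := by
      simp only [dotProduct, Fin.sum_univ_three]
      exact add_nonneg (add_nonneg (mul_self_nonneg _) (mul_self_nonneg _)) (mul_self_nonneg _)
    nlinarith

lemma inv_one_add_height_mul (κ : SignType) (p : Fin 3 → ℝ) :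
    (1 + height κ p)⁻¹ * (1 + height κ p) = 1 := inv_mul_cancel₀ (one_add_height_pos κ p).ne'

lemma dual_boost_dotProduct {κ : SignType} (hκ : κ ≠ 1) (p a b : Fin 3 → ℝ) :
    dual κ (boost κ p a) ⬝ᵥ dual κ (boost κ p b) = ⟨a ⬝ᵥ b, 0⟩ := by
  rw [dual_dotProduct]
  have hh := height_sq hκ p
  have hk := inv_one_add_height_mul κ p
  simp only [boost, dotProduct, Fin.sum_univ_three, Matrix.cons_val]
  generalize height κ p = h at *
  generalize (1 + h)⁻¹ = k at *
  constructor
  · linear_combination (a 0 * b 0 + a 1 * b 1 + a 2 * b 2) * hh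
      + κ * (p 0 * a 0 + p 1 * a 1 + p 2 * a 2) * (p 0 * b 0 + p 1 * b 1 + p 2 * b 2)
        * ((1 + k * (1 - h)) * hk + k ^ 2 * hh)
  · ring

lemma boost_mem_dualPairs {κ : SignType} (hκ : κ ≠ 1) (p : Fin 3 → ℝ)
    {z : (Fin 3 → ℝ) × (Fin 3 → ℝ)} (hz : z ∈ orthoPairs) :
    (boost κ p z.1, boost κ p z.2) ∈ dualPairs κ := by
  obtain ⟨h1, h2, h3⟩ := hz
  refine ⟨?_, ?_, ?_⟩
  · rw [dual_boost_dotProduct hκ, h1]; rfl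
  · rw [dual_boost_dotProduct hκ, h2]; rfl
  · rw [dual_boost_dotProduct hκ, h3]; rfl

lemma unboost_boost {κ : SignType} (hκ : κ ≠ 1) (p a : Fin 3 → ℝ) :
    unboost κ p (boost κ p a) = a := by
  have hh := height_sq hκ p
  have hk := inv_one_add_height_mul κ p
  simp only [boost, unboost, dotProduct, Fin.sum_univ_three, Matrix.cons_val]
  generalize height κ p = h at *
  generalize (1 + h)⁻¹ = k at *
  ext i
  fin_cases i <;> simp only [Matrix.cons_val, Fin.zero_eta, Fin.mk_one, Fin.reduceFinMk]
  · linear_combination a 0 * hh + κ * (p 0 * a 0 + p 1 * a 1 + p 2 * a 2) * p 0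
        * ((1 + k * (1 - h)) * hk + k ^ 2 * hh)
  · linear_combination a 1 * hh + κ * (p 0 * a 0 + p 1 * a 1 + p 2 * a 2) * p 1
        * ((1 + k * (1 - h)) * hk + k ^ 2 * hh)
  · linear_combination a 2 * hh + κ * (p 0 * a 0 + p 1 * a 1 + p 2 * a 2) * p 2
        * ((1 + k * (1 - h)) * hk + k ^ 2 * hh)

/-- The cross product of `ℝ[ω]³`, in coordinates. -/
def dualCross (κ : SignType) (w z : Fin 6 → ℝ) : Fin 6 → ℝ :=
  ![w 1 * z 2 - w 2 * z 1 + κ * (w 4 * z 5 - w 5 * z 4),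
    w 2 * z 0 - w 0 * z 2 + κ * (w 5 * z 3 - w 3 * z 5),
    w 0 * z 1 - w 1 * z 0 + κ * (w 3 * z 4 - w 4 * z 3),
    w 1 * z 5 - w 2 * z 4 + (w 4 * z 2 - w 5 * z 1),
    w 2 * z 3 - w 0 * z 5 + (w 5 * z 0 - w 3 * z 2),
    w 0 * z 4 - w 1 * z 3 + (w 3 * z 1 - w 4 * z 0)]

lemma dualCross_boost {κ : SignType} (hκ : κ ≠ 1) (p a b : Fin 3 → ℝ) :
    dualCross κ (boost κ p a) (boost κ p b) = boost κ p (crossProduct a b) := by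
  have hh := height_sq hκ p
  have hk := inv_one_add_height_mul κ p
  simp only [boost, dualCross, crossProduct, LinearMap.mk₂_apply, dotProduct, Fin.sum_univ_three,
    Matrix.cons_val]
  generalize height κ p = h at *
  generalize (1 + h)⁻¹ = k at *
  ext i
  fin_cases i <;> simp only [Matrix.cons_val, Fin.zero_eta, Fin.mk_one, Fin.reduceFinMk]
  · linear_combination (a 1 * b 2 - a 2 * b 1) * (h * k * hh + h * (1 - h) * hk)
      - κ * (p 0 * (a 1 * b 2 - a 2 * b 1) + p 1 * (a 2 * b 0 - a 0 * b 2)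
        + p 2 * (a 0 * b 1 - a 1 * b 0)) * p 0 * hk
  · linear_combination (a 2 * b 0 - a 0 * b 2) * (h * k * hh + h * (1 - h) * hk)
      - κ * (p 0 * (a 1 * b 2 - a 2 * b 1) + p 1 * (a 2 * b 0 - a 0 * b 2)
        + p 2 * (a 0 * b 1 - a 1 * b 0)) * p 1 * hk
  · linear_combination (a 0 * b 1 - a 1 * b 0) * (h * k * hh + h * (1 - h) * hk)
      - κ * (p 0 * (a 1 * b 2 - a 2 * b 1) + p 1 * (a 2 * b 0 - a 0 * b 2)
        + p 2 * (a 0 * b 1 - a 1 * b 0)) * p 2 * hk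
  · linear_combination (p 1 * (a 0 * b 1 - a 1 * b 0) - p 2 * (a 2 * b 0 - a 0 * b 2))
      * (k * hh + (1 - h) * hk)
  · linear_combination (p 2 * (a 1 * b 2 - a 2 * b 1) - p 0 * (a 0 * b 1 - a 1 * b 0))
      * (k * hh + (1 - h) * hk)
  · linear_combination (p 0 * (a 2 * b 0 - a 0 * b 2) - p 1 * (a 1 * b 2 - a 2 * b 1))
      * (k * hh + (1 - h) * hk)

lemma sum_mul_of_mem_orthoPairs {z : (Fin 3 → ℝ) × (Fin 3 → ℝ)} (hz : z ∈ orthoPairs)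
    (i j : Fin 3) : z.1 i * z.1 j + z.2 i * z.2 j
      + crossProduct z.1 z.2 i * crossProduct z.1 z.2 j = if i = j then 1 else 0 := by
  obtain ⟨h1, h2, h3⟩ := hz
  have hc : crossProduct z.1 z.2 ⬝ᵥ crossProduct z.1 z.2 = 1 := by
    rw [cross_dot_cross, h1, h2, h3, dotProduct_comm, h3]; norm_num
  have h := congrFun (eq_sum_of_orthonormal h1 h2 hc h3 (dot_self_cross _ _) (dot_cross_self _ _)
    (Pi.single j 1)) i
  simp only [dotProduct_single, mul_one, Pi.add_apply, Pi.smul_apply, smul_eq_mul,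
    Pi.single_apply] at h
  rw [h]; ring

/-- The point `p` recovered from the bivectors `boost κ p a` and `boost κ p b`. If `v` and `m` are
the real and the `ω`-part of the columns of the orthogonal matrix over `ℝ[ω]` that they define, then
`∑ |m|² = 2 |p|²` and `∑ v × m = 2 h p` with `h` the height of `p`. -/
noncomputable def boostPoint (κ : SignType) (z : (Fin 6 → ℝ) × (Fin 6 → ℝ)) : Fin 3 → ℝ :=
  let x := z.1
  let y := z.2
  let c := dualCross κ x y
  let M := x 3 ^ 2 + x 4 ^ 2 + x 5 ^ 2 + (y 3 ^ 2 + y 4 ^ 2 + y 5 ^ 2)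
    + (c 3 ^ 2 + c 4 ^ 2 + c 5 ^ 2)
  (2 * √(1 - κ * (M / 2)))⁻¹ •
    ![x 1 * x 5 - x 2 * x 4 + (y 1 * y 5 - y 2 * y 4) + (c 1 * c 5 - c 2 * c 4),
      x 2 * x 3 - x 0 * x 5 + (y 2 * y 3 - y 0 * y 5) + (c 2 * c 3 - c 0 * c 5),
      x 0 * x 4 - x 1 * x 3 + (y 0 * y 4 - y 1 * y 3) + (c 0 * c 4 - c 1 * c 3)]

lemma continuous_boostPoint {κ : SignType} (hκ : κ ≠ 1) : Continuous (boostPoint κ) := by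
  have hc : Continuous fun z : (Fin 6 → ℝ) × (Fin 6 → ℝ) => dualCross κ z.1 z.2 := by
    unfold dualCross
    fun_prop
  have hi : ∀ i : Fin 6, Continuous fun z : (Fin 6 → ℝ) × (Fin 6 → ℝ) => dualCross κ z.1 z.2 i :=
    fun i => (continuous_apply i).comp hc
  have hM : Continuous fun z : (Fin 6 → ℝ) × (Fin 6 → ℝ) =>
      (2 * √(1 - κ * ((z.1 3 ^ 2 + z.1 4 ^ 2 + z.1 5 ^ 2 + (z.2 3 ^ 2 + z.2 4 ^ 2 + z.2 5 ^ 2)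
        + (dualCross κ z.1 z.2 3 ^ 2 + dualCross κ z.1 z.2 4 ^ 2
          + dualCross κ z.1 z.2 5 ^ 2)) / 2)))⁻¹ := by
    refine Continuous.inv₀ (by fun_prop) fun z => ?_
    have h := cast_nonpos hκ
    refine mul_ne_zero two_ne_zero (Real.sqrt_pos.2 ?_).ne'
    refine add_pos_of_pos_of_nonneg one_pos (neg_nonneg.2 (mul_nonpos_of_nonpos_of_nonneg h ?_))
    positivity
  refine continuous_pi fun i => hM.mul (g := fun z : (Fin 6 → ℝ) × (Fin 6 → ℝ) =>
    (![_, _, _] : Fin 3 → ℝ) i) ?_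
  fin_cases i <;> simp only [Matrix.cons_val, Fin.zero_eta, Fin.mk_one, Fin.reduceFinMk] <;>
    fun_prop

lemma boostPoint_boost {κ : SignType} (hκ : κ ≠ 1) (p : Fin 3 → ℝ)
    {z : (Fin 3 → ℝ) × (Fin 3 → ℝ)} (hz : z ∈ orthoPairs) :
    boostPoint κ (boost κ p z.1, boost κ p z.2) = p := by
  have hS := sum_mul_of_mem_orthoPairs hz
  have hh := height_sq hκ p
  have hpos : height κ p ≠ 0 := by
    have h := cast_nonpos hκ
    intro h0
    rw [h0] at hh
    nlinarith [sq_nonneg (p 0), sq_nonneg (p 1), sq_nonneg (p 2)]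
  have h00 := hS 0 0
  have h11 := hS 1 1
  have h22 := hS 2 2
  have h01 := hS 0 1
  have h02 := hS 0 2
  have h12 := hS 1 2
  simp only [boostPoint, dualCross_boost hκ]
  obtain ⟨a, b⟩ := z
  simp only at *
  generalize crossProduct a b = c at *
  simp only [↓reduceIte, Fin.reduceEq] at h00 h11 h22 h01 h02 h12
  have hM : (boost κ p a 3 ^ 2 + boost κ p a 4 ^ 2 + boost κ p a 5 ^ 2
      + (boost κ p b 3 ^ 2 + boost κ p b 4 ^ 2 + boost κ p b 5 ^ 2)
      + (boost κ p c 3 ^ 2 + boost κ p c 4 ^ 2 + boost κ p c 5 ^ 2)) / 2 = p ⬝ᵥ p := by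
    simp only [boost, Matrix.cons_val, dotProduct, Fin.sum_univ_three]
    linear_combination ((p 1 ^ 2 + p 2 ^ 2) * h00 + (p 0 ^ 2 + p 2 ^ 2) * h11
      + (p 0 ^ 2 + p 1 ^ 2) * h22) / 2 - p 0 * p 1 * h01 - p 0 * p 2 * h02 - p 1 * p 2 * h12
  rw [hM, show √(1 - κ * (p ⬝ᵥ p)) = height κ p from rfl]
  simp only [boost, dotProduct, Fin.sum_univ_three]
  generalize height κ p = h at *
  generalize (1 + h)⁻¹ = k at *
  ext i
  rw [Pi.smul_apply, smul_eq_mul, inv_mul_eq_iff_eq_mul₀ (mul_ne_zero two_ne_zero hpos)]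
  fin_cases i <;> simp only [Matrix.cons_val, Fin.zero_eta, Fin.mk_one, Fin.reduceFinMk]
  · linear_combination h * (p 0 * (h00 + h11 + h22) - (p 0 * h00 + p 1 * h01 + p 2 * h02))
      + κ * k * (p 0 * (p 0 ^ 2 * h00 + p 1 ^ 2 * h11 + p 2 ^ 2 * h22 + 2 * p 0 * p 1 * h01
        + 2 * p 0 * p 2 * h02 + 2 * p 1 * p 2 * h12)
        - (p 0 ^ 2 + p 1 ^ 2 + p 2 ^ 2) * (p 0 * h00 + p 1 * h01 + p 2 * h02))
  · linear_combination h * (p 1 * (h00 + h11 + h22) - (p 0 * h01 + p 1 * h11 + p 2 * h12))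
      + κ * k * (p 1 * (p 0 ^ 2 * h00 + p 1 ^ 2 * h11 + p 2 ^ 2 * h22 + 2 * p 0 * p 1 * h01
        + 2 * p 0 * p 2 * h02 + 2 * p 1 * p 2 * h12)
        - (p 0 ^ 2 + p 1 ^ 2 + p 2 ^ 2) * (p 0 * h01 + p 1 * h11 + p 2 * h12))
  · linear_combination h * (p 2 * (h00 + h11 + h22) - (p 0 * h02 + p 1 * h12 + p 2 * h22))
      + κ * k * (p 2 * (p 0 ^ 2 * h00 + p 1 ^ 2 * h11 + p 2 ^ 2 * h22 + 2 * p 0 * p 1 * h01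
        + 2 * p 0 * p 2 * h02 + 2 * p 1 * p 2 * h12)
        - (p 0 ^ 2 + p 1 ^ 2 + p 2 ^ 2) * (p 0 * h02 + p 1 * h12 + p 2 * h22))

/-- The spatial part of the parallel translate of `x` from `p` to the point `(1, 0, 0, 0)`. -/
noncomputable def unboostVector (p x : Fin 4 → ℝ) : Fin 3 → ℝ :=
  fun i => x i.succ - x 0 * (1 + p 0)⁻¹ * p i.succ

lemma height_of_mem {κ : SignType} (hκ : κ ≠ 1) {p : Fin 4 → ℝ} (hp : p ∈ spaceForm κ) :
    height κ (fun i => p i.succ) = p 0 := by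
  obtain ⟨h1, h2⟩ := hp
  rw [height, Real.sqrt_eq_iff_mul_self_eq_of_pos (h2 hκ)]
  simp [dualForm, dotProduct, Fin.sum_univ_three] at *
  linarith

lemma unboostVector_dotProduct {κ : SignType} (hκ : κ ≠ 1) {p x y : Fin 4 → ℝ}
    (hp : p ∈ spaceForm κ) (hx : x ∈ tangentPlane κ p) (hy : y ∈ tangentPlane κ p) :
    unboostVector p x ⬝ᵥ unboostVector p y = form κ x y := by
  have hk : (1 + p 0)⁻¹ * (1 + p 0) = 1 := inv_mul_cancel₀ (by linarith [hp.2 hκ])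
  rcases κ.trichotomy with rfl | rfl | rfl
  · have h1 := hp.1
    simp [tangentPlane, dualForm, form, unboostVector, dotProduct, Fin.sum_univ_three] at *
    generalize (1 + p 0)⁻¹ = k at *
    linear_combination x 0 * y 0 * (k ^ 2 * -h1 + (-2 + 1 * (1 - k * (1 - p 0))) * hk)
      + x 0 * k * hy + y 0 * k * hx
  · obtain ⟨-, x0⟩ := zero_coord_of_tangent hp hx
    obtain ⟨-, y0⟩ := zero_coord_of_tangent hp hy
    simp [unboostVector, form, x0, y0, dotProduct, Fin.sum_univ_three]
  · exact absurd rfl hκ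

lemma boost_unboostVector {κ : SignType} (hκ : κ ≠ 1) {p x : Fin 4 → ℝ} (hp : p ∈ spaceForm κ)
    (hx : x ∈ tangentPlane κ p) :
    boost κ (fun i => p i.succ) (unboostVector p x) = wedge p x := by
  have hk : (1 + p 0)⁻¹ * (1 + p 0) = 1 := inv_mul_cancel₀ (by linarith [hp.2 hκ])
  have h1 := hp.1
  have key : (κ : ℝ) * ((fun i => p i.succ) ⬝ᵥ unboostVector p x) = -x 0 := by
    simp [tangentPlane, dualForm, unboostVector, dotProduct, Fin.sum_univ_three] at *
    generalize (1 + p 0)⁻¹ = k at *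
    linear_combination hx - x 0 * k * h1 - x 0 * (1 - p 0) * hk
  simp only [boost, height_of_mem hκ hp, key]
  ext i
  fin_cases i <;> simp [unboostVector, wedge] <;> generalize (1 + p 0)⁻¹ = k at *
  · linear_combination -x 0 * p 1 * hk
  · linear_combination -x 0 * p 2 * hk
  · linear_combination -x 0 * p 3 * hk
  all_goals ring

lemma exists_boost_eq {κ : SignType} (hκ : κ ≠ 1) {z : (Fin 6 → ℝ) × (Fin 6 → ℝ)}
    (hz : z ∈ dualPairs κ) : ∃ p, ∃ x ∈ orthoPairs, (boost κ p x.1, boost κ p x.2) = z := by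
  obtain ⟨p, u, b, hp, h, h1, h2⟩ := exists_frame_of_mem_dualPairs hz
  refine ⟨fun i => p i.succ, (unboostVector p u, unboostVector p b), ⟨?_, ?_, ?_⟩, ?_⟩
  · rw [unboostVector_dotProduct hκ hp h.left_mem h.left_mem, h.left_unit]
  · rw [unboostVector_dotProduct hκ hp h.right_mem h.right_mem, h.right_unit]
  · rw [unboostVector_dotProduct hκ hp h.left_mem h.right_mem, h.orthogonal]
  · rw [boost_unboostVector hκ hp h.left_mem, boost_unboostVector hκ hp h.right_mem, h1, h2]

/-- The pair of vectors recovered from the bivectors `boost κ p a` and `boost κ p b`. -/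
noncomputable def boostPair (κ : SignType) (z : (Fin 6 → ℝ) × (Fin 6 → ℝ)) :
    (Fin 3 → ℝ) × (Fin 3 → ℝ) :=
  (unboost κ (boostPoint κ z) z.1, unboost κ (boostPoint κ z) z.2)

lemma boostPair_boost {κ : SignType} (hκ : κ ≠ 1) (p : Fin 3 → ℝ)
    {x : (Fin 3 → ℝ) × (Fin 3 → ℝ)} (hx : x ∈ orthoPairs) :
    boostPair κ (boost κ p x.1, boost κ p x.2) = x := by
  rw [boostPair, boostPoint_boost hκ p hx, unboost_boost hκ, unboost_boost hκ]

lemma continuous_boostPair {κ : SignType} (hκ : κ ≠ 1) : Continuous (boostPair κ) := by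
  have hp := continuous_boostPoint hκ
  have hu := continuous_unboost κ
  have h1 : Continuous fun z : (Fin 6 → ℝ) × (Fin 6 → ℝ) => unboost κ (boostPoint κ z) z.1 :=
    hu.comp (f := fun z : (Fin 6 → ℝ) × (Fin 6 → ℝ) => (boostPoint κ z, z.1)) (by fun_prop)
  have h2 : Continuous fun z : (Fin 6 → ℝ) × (Fin 6 → ℝ) => unboost κ (boostPoint κ z) z.2 :=
    hu.comp (f := fun z : (Fin 6 → ℝ) × (Fin 6 → ℝ) => (boostPoint κ z, z.2)) (by fun_prop)
  exact h1.prodMk h2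

lemma boostPair_mem {κ : SignType} (hκ : κ ≠ 1) {z : (Fin 6 → ℝ) × (Fin 6 → ℝ)}
    (hz : z ∈ dualPairs κ) : boostPair κ z ∈ orthoPairs := by
  obtain ⟨p, x, hx, rfl⟩ := exists_boost_eq hκ hz
  rwa [boostPair_boost hκ p hx]

lemma hasContinuousLogs_fun : HasContinuousLogs (Fin 3 → ℝ) :=
  (hasContinuousLogs_of_convex (convex_univ (𝕜 := ℝ) (E := Fin 3 → ℝ)) univ_nonempty).of_retract
    continuous_subtype_val (r := fun x => ⟨x, mem_univ x⟩) (by fun_prop) fun _ => rfl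

lemma hasContinuousLogs_dualPairs_of_ne_one {κ : SignType} (hκ : κ ≠ 1) :
    HasContinuousLogs (dualPairs κ) := by
  let q : (Fin 3 → ℝ) × orthoPairs → dualPairs κ := fun z =>
    ⟨(boost κ z.1 z.2.1.1, boost κ z.1 z.2.1.2), boost_mem_dualPairs hκ z.1 z.2.2⟩
  let r : dualPairs κ → (Fin 3 → ℝ) × orthoPairs := fun z =>
    (boostPoint κ z.1, ⟨boostPair κ z.1, boostPair_mem hκ z.2⟩)
  have hq : Continuous q := by
    refine Continuous.subtype_mk (Continuous.prodMk ?_ ?_) _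
    · exact (continuous_boost κ).comp
        (f := fun z : (Fin 3 → ℝ) × orthoPairs => (z.1, z.2.1.1)) (by fun_prop)
    · exact (continuous_boost κ).comp
        (f := fun z : (Fin 3 → ℝ) × orthoPairs => (z.1, z.2.1.2)) (by fun_prop)
  have hr : Continuous r := ((continuous_boostPoint hκ).comp continuous_subtype_val).prodMk
    (((continuous_boostPair hκ).comp continuous_subtype_val).subtype_mk _)
  refine (hasContinuousLogs_fun.prod hasContinuousLogs_orthoPairs).of_retract hq hr ?_
  rintro ⟨z, hz⟩
  apply Subtype.ext
  change (boost κ (boostPoint κ z) (boostPair κ z).1, boost κ (boostPoint κ z) (boostPair κ z).2)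
    = z
  obtain ⟨p, x, hx, rfl⟩ := exists_boost_eq hκ hz
  rw [boostPair_boost hκ p hx, boostPoint_boost hκ p hx]

lemma hasContinuousLogs_dualPairs (κ : SignType) : HasContinuousLogs (dualPairs κ) := by
  by_cases hκ : κ = 1
  · subst hκ; exact hasContinuousLogs_dualPairs_one
  · exact hasContinuousLogs_dualPairs_of_ne_one hκ

/-! ### The Plücker embedding of the tangent bundle -/

namespace OrientedGeodesic

variable {κ : SignType}

lemma pluckerChart_mem_maximalAtlas (κ : SignType) (i : Fin 6) (s : ℤˣ) :
    pluckerChart κ i s ∈ IsManifold.maximalAtlas (𝓡 4) ∞ (OrientedGeodesic κ) :=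
  IsManifold.subset_maximalAtlas (mem_range_self (i, s))

lemma contMDiff_plucker : ContMDiff (𝓡 4) 𝓘(ℝ, Fin 6 → ℝ) ∞ (plucker (κ := κ)) := by
  intro l
  obtain ⟨⟨i, s⟩, h⟩ := exists_mem_source κ l
  have h1 := contMDiffOn_of_mem_maximalAtlas (pluckerChart_mem_maximalAtlas κ i s)
  have h2 : ContMDiffOn (𝓡 4) 𝓘(ℝ, Fin 6 → ℝ) ∞ (chartInv κ i s)
      {x | 0 < pluckerNorm κ (chartLift i s x)} := (contDiffOn_chartInv κ i s).contMDiffOn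
  have h3 : ContMDiffOn (𝓡 4) 𝓘(ℝ, Fin 6 → ℝ) ∞ (plucker (κ := κ)) (pluckerChart κ i s).source :=
    (h2.comp h1 fun m hm => (pluckerChart κ i s).map_source hm).congr fun m hm =>
      (chartInv_chartFun κ i s (plucker_mem m) hm).symm
  exact h3.contMDiffAt ((pluckerChart κ i s).open_source.mem_nhds h)

/-- A left inverse of `plucker` on the domain of the chart with indices `i` and `s`, smooth in a
neighbourhood of the image of this domain in `ℝ⁶`. -/
noncomputable def pluckerInv (κ : SignType) (i : Fin 6) (s : ℤˣ) (w : Fin 6 → ℝ) :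
    OrientedGeodesic κ :=
  (pluckerChart κ i s).symm (chartFun i s w)

/-- The open set on which `pluckerInv` is smooth. -/
def pluckerDomain (κ : SignType) (i : Fin 6) (s : ℤˣ) : Set (Fin 6 → ℝ) :=
  {w | 0 < (s : ℤ) * w i} ∩ chartFun i s ⁻¹' {x | 0 < pluckerNorm κ (chartLift i s x)}

lemma isOpen_pluckerDomain (κ : SignType) (i : Fin 6) (s : ℤˣ) :
    IsOpen (pluckerDomain κ i s) := by
  refine (contDiffOn_chartFun i s).continuousOn.isOpen_inter_preimage ?_
    (pluckerChart κ i s).open_target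
  exact isOpen_lt continuous_const (by fun_prop)

lemma contMDiffOn_pluckerInv (κ : SignType) (i : Fin 6) (s : ℤˣ) :
    ContMDiffOn 𝓘(ℝ, Fin 6 → ℝ) (𝓡 4) ∞ (pluckerInv κ i s) (pluckerDomain κ i s) := by
  have h1 := contMDiffOn_symm_of_mem_maximalAtlas (pluckerChart_mem_maximalAtlas κ i s)
  have h2 : ContMDiffOn 𝓘(ℝ, Fin 6 → ℝ) (𝓡 4) ∞ (chartFun i s) {w | 0 < (s : ℤ) * w i} :=
    (contDiffOn_chartFun i s).contMDiffOn
  exact h1.comp (h2.mono inter_subset_left) fun w hw => hw.2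

lemma pluckerInv_plucker {i : Fin 6} {s : ℤˣ} {l : OrientedGeodesic κ}
    (h : l ∈ (pluckerChart κ i s).source) : pluckerInv κ i s (plucker l) = l :=
  (pluckerChart κ i s).left_inv h

lemma plucker_mem_pluckerDomain {i : Fin 6} {s : ℤˣ} {l : OrientedGeodesic κ}
    (h : l ∈ (pluckerChart κ i s).source) : plucker l ∈ pluckerDomain κ i s :=
  ⟨h, (pluckerChart κ i s).map_source h⟩

/-- The differential of `pluckerInv` is a left inverse of the differential of `plucker`, so that the
latter is an embedding. -/
lemma tangentMap_pluckerInv {i : Fin 6} {s : ℤˣ} {v : TangentBundle (𝓡 4) (OrientedGeodesic κ)}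
    (h : v.proj ∈ (pluckerChart κ i s).source) :
    tangentMapWithin 𝓘(ℝ, Fin 6 → ℝ) (𝓡 4) (pluckerInv κ i s) (pluckerDomain κ i s)
      (tangentMap (𝓡 4) 𝓘(ℝ, Fin 6 → ℝ) plucker v) = v := by
  have hm := plucker_mem_pluckerDomain h
  have hd : MDifferentiableAt 𝓘(ℝ, Fin 6 → ℝ) (𝓡 4) (pluckerInv κ i s) (plucker v.proj) :=
    ((contMDiffOn_pluckerInv κ i s).contMDiffAt
      ((isOpen_pluckerDomain κ i s).mem_nhds hm)).mdifferentiableAt (by simp)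
  have hp : MDifferentiableAt (𝓡 4) 𝓘(ℝ, Fin 6 → ℝ) (plucker (κ := κ)) v.proj :=
    (contMDiff_plucker v.proj).mdifferentiableAt (by simp)
  rw [tangentMapWithin_eq_tangentMap ((isOpen_pluckerDomain κ i s).uniqueMDiffWithinAt hm) hd,
    ← tangentMap_comp_at v hd hp]
  have he : pluckerInv κ i s ∘ plucker =ᶠ[𝓝 v.proj] id :=
    eventually_of_mem ((pluckerChart κ i s).open_source.mem_nhds h) fun m hm =>
      pluckerInv_plucker hm
  have h1 := he.mfderiv_eq (I := 𝓡 4) (I' := 𝓡 4)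
  rw [mfderiv_id] at h1
  refine Bundle.TotalSpace.ext he.eq_of_nhds (heq_of_eq ?_)
  exact congrArg (fun L : EuclideanSpace ℝ (Fin 4) →L[ℝ] EuclideanSpace ℝ (Fin 4) => L v.2) h1

lemma tangentMap_plucker_injective :
    Function.Injective (tangentMap (𝓡 4) 𝓘(ℝ, Fin 6 → ℝ) (plucker (κ := κ))) := by
  intro v v' h
  have h1 : v.proj = v'.proj := plucker_injective (congrArg Bundle.TotalSpace.proj h)
  obtain ⟨⟨i, s⟩, hl⟩ := exists_mem_source κ v.proj
  rw [← tangentMap_pluckerInv hl, h, tangentMap_pluckerInv (h1 ▸ hl)]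

lemma isInducing_tangentMap_plucker :
    IsInducing (tangentMap (𝓡 4) 𝓘(ℝ, Fin 6 → ℝ) (plucker (κ := κ))) := by
  rw [isInducing_iff_nhds]
  intro v
  refine le_antisymm (contMDiff_plucker.continuous_tangentMap (by simp)).continuousAt.le_comap ?_
  obtain ⟨⟨i, s⟩, hl⟩ := exists_mem_source κ v.proj
  set T := tangentMap (𝓡 4) 𝓘(ℝ, Fin 6 → ℝ) (plucker (κ := κ)) with hT
  set g := tangentMapWithin 𝓘(ℝ, Fin 6 → ℝ) (𝓡 4) (pluckerInv κ i s) (pluckerDomain κ i s)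
  have hpr : Continuous (Bundle.TotalSpace.proj :
      TangentBundle 𝓘(ℝ, Fin 6 → ℝ) (Fin 6 → ℝ) → Fin 6 → ℝ) :=
    FiberBundle.continuous_proj (Fin 6 → ℝ) _
  have hg : ContinuousAt g (T v) :=
    ((contMDiffOn_pluckerInv κ i s).continuousOn_tangentMapWithin (by simp)
      (isOpen_pluckerDomain κ i s).uniqueMDiffOn).continuousAt
      (((isOpen_pluckerDomain κ i s).preimage hpr).mem_nhds (plucker_mem_pluckerDomain hl))
  have hgv : g (T v) = v := tangentMap_pluckerInv hl
  have h1 : Tendsto (g ∘ T) (comap T (𝓝 (T v))) (𝓝 v) := by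
    rw [ContinuousAt, hgv] at hg
    exact hg.comp tendsto_comap
  have hopen : IsOpen {w : TangentBundle 𝓘(ℝ, Fin 6 → ℝ) (Fin 6 → ℝ) | 0 < (s : ℤ) * w.proj i} :=
    isOpen_lt continuous_const (continuous_const.mul ((continuous_apply i).comp hpr))
  have h2 : g ∘ T =ᶠ[comap T (𝓝 (T v))] id :=
    eventually_of_mem (preimage_mem_comap (hopen.mem_nhds hl)) fun v' hv' =>
      tangentMap_pluckerInv hv'
  exact tendsto_id'.1 (h1.congr' h2)

/-- The embedding of `T𝒢_κ` into `ℝ⁶ × ℝ⁶` given by the Plücker coordinates and their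
differentials. -/
noncomputable def tangentPlucker (v : TangentBundle (𝓡 4) (OrientedGeodesic κ)) :
    (Fin 6 → ℝ) × (Fin 6 → ℝ) :=
  (plucker v.proj, mfderiv (𝓡 4) 𝓘(ℝ, Fin 6 → ℝ) plucker v.proj v.2)

lemma isEmbedding_tangentPlucker : IsEmbedding (tangentPlucker (κ := κ)) := by
  have h : IsEmbedding (tangentMap (𝓡 4) 𝓘(ℝ, Fin 6 → ℝ) (plucker (κ := κ))) :=
    ⟨isInducing_tangentMap_plucker, tangentMap_plucker_injective⟩
  exact (tangentBundleModelSpaceHomeomorph 𝓘(ℝ, Fin 6 → ℝ)).isEmbedding.comp h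

lemma tangentPlucker_velocity {Γ : ℝ → OrientedGeodesic κ}
    (h : MDifferentiableAt 𝓘(ℝ, ℝ) (𝓡 4) Γ 0) {y : Fin 6 → ℝ}
    (hy : HasDerivAt (fun t => plucker (Γ t)) y 0) :
    tangentPlucker ⟨Γ 0, mfderiv 𝓘(ℝ, ℝ) (𝓡 4) Γ 0 (1 : ℝ)⟩ = (plucker (Γ 0), y) := by
  have hp : MDifferentiableAt (𝓡 4) 𝓘(ℝ, Fin 6 → ℝ) (plucker (κ := κ)) (Γ 0) :=
    (contMDiff_plucker (Γ 0)).mdifferentiableAt (by simp)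
  refine Prod.ext rfl ?_
  have h1 := mfderiv_comp_apply 0 hp h (1 : ℝ)
  rw [mfderiv_eq_fderiv] at h1
  change mfderiv (𝓡 4) 𝓘(ℝ, Fin 6 → ℝ) plucker (Γ 0) _ = y
  refine h1.symm.trans ?_
  change fderiv ℝ (fun t => plucker (Γ t)) 0 1 = y
  rw [fderiv_apply_one_eq_deriv, hy.deriv]

/-- As `plucker` has smooth local left inverses, a curve in `𝒢_κ` is differentiable if its Plücker
coordinates are. -/
lemma mdifferentiableAt_of_plucker {Γ : ℝ → OrientedGeodesic κ} {t : ℝ}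
    (h : DifferentiableAt ℝ (fun t => plucker (Γ t)) t) :
    MDifferentiableAt 𝓘(ℝ, ℝ) (𝓡 4) Γ t := by
  obtain ⟨⟨i, s⟩, hl⟩ := exists_mem_source κ (Γ t)
  have hd : MDifferentiableAt 𝓘(ℝ, Fin 6 → ℝ) (𝓡 4) (pluckerInv κ i s) (plucker (Γ t)) :=
    ((contMDiffOn_pluckerInv κ i s).contMDiffAt ((isOpen_pluckerDomain κ i s).mem_nhds
      (plucker_mem_pluckerDomain hl))).mdifferentiableAt (by simp)
  have hc : ContinuousAt Γ t := isInducing_plucker.continuousAt_iff.2 h.continuousAt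
  refine (hd.comp t h.mdifferentiableAt).congr_of_eventuallyEq ?_
  filter_upwards [hc ((pluckerChart κ i s).open_source.mem_nhds hl)] with t' ht'
  exact (pluckerInv_plucker ht').symm

end OrientedGeodesic

/-! ### Velocities of helicoidal curves -/

open OrientedGeodesic

variable {κ : SignType} {α : ℝ}

lemma hasDerivAt_wedge {x y : ℝ → Fin 4 → ℝ} {x' y' : Fin 4 → ℝ} {t : ℝ}
    (hx : HasDerivAt x x' t) (hy : HasDerivAt y y' t) :
    HasDerivAt (fun s => wedge (x s) (y s)) (wedge x' (y t) + wedge (x t) y') t := by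
  have hx := hasDerivAt_pi.1 hx
  have hy := hasDerivAt_pi.1 hy
  have key : ∀ i j : Fin 4, HasDerivAt (fun s => x s i * y s j - x s j * y s i)
      (x' i * y t j - x' j * y t i + (x t i * y' j - x t j * y' i)) t := fun i j =>
    (((hx i).mul (hy j)).sub ((hx j).mul (hy i))).congr_deriv (by ring)
  rw [hasDerivAt_pi]
  intro i
  fin_cases i
  exacts [key 0 1, key 0 2, key 0 3, key 2 3, key 3 1, key 1 2]

/-- A parallel field along a geodesic that is orthogonal to the velocity at `t` is stationary
there. -/
lemma IsParallelAlong.deriv_eq_zero {γ : UnitGeodesic κ} {V : ℝ → Fin 4 → ℝ}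
    (hV : IsParallelAlong κ γ.curve V) {t : ℝ} (h : form κ (deriv γ.curve t) (V t) = 0) :
    deriv V t = 0 := by
  have hd := hasDerivAt_dualForm κ (γ.hasDerivAt t)
    ((hV.smooth.differentiable (by simp)).differentiableAt (x := t)).hasDerivAt
  have h0 : (fun s => dualForm κ (γ.curve s) (V s)) = fun _ => 0 :=
    funext fun s => hV.tangent s
  rw [h0, dualForm_of_tangent (γ.mem t) (γ.geodesic.tangent t), h, mul_zero, zero_add] at hd
  have ht : deriv V t ∈ tangentPlane κ (γ.curve t) := hd.unique (hasDerivAt_const t (0 : ℝ))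
  exact eq_zero_of_form_self (γ.mem t) ht (hV.parallel t _ ht)

/-- The initial velocity of the helicoidal curve with the frame `p, A, u` is
`A ∧ u + α (p ∧ (A × u)) = (α + ω) (p ∧ (A × u))`. -/
lemma IsHelicoidalCurve.exists_hasDerivAt {l : OrientedGeodesic κ} {p A : Fin 4 → ℝ}
    {Γ : ℝ → OrientedGeodesic κ} (h : IsHelicoidalCurve κ α l p A Γ) :
    ∃ u, p ∈ spaceForm κ ∧ IsOrthonormalPair κ p A u ∧ plucker l = wedge p u ∧
      plucker (Γ 0) = wedge p u ∧
      HasDerivAt (fun t => plucker (Γ t))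
        (scalarMul (⟨α, 1⟩ : Scalar κ) (wedge p (cross κ p A u))) 0 := by
  obtain ⟨σ, γ, V, B, rfl, rfl, hγ, rfl, horth, hV, hV0, hB, hB0, hΓ⟩ := h
  have hp := σ.mem 0
  have hA := γ.geodesic.tangent 0
  rw [hγ] at hA
  have hAu : IsOrthonormalPair κ (σ.curve 0) (deriv γ.curve 0) (deriv σ.curve 0) :=
    ⟨hA, σ.geodesic.tangent 0, γ.unit_speed 0, σ.unit_speed 0, horth⟩
  have hpl : ∀ t, plucker (Γ t)
      = wedge (γ.curve t) (Real.cos (α * t) • V t + Real.sin (α * t) • B t) := by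
    intro t
    obtain ⟨τ, h1, h2, h3⟩ := hΓ t
    rw [h1, ← h2, ← h3]
    rfl
  refine ⟨_, hp, hAu, rfl, ?_, ?_⟩
  · rw [hpl]; simp [hγ, hV0]
  · have hV' : HasDerivAt V 0 0 := by
      rw [← hV.deriv_eq_zero (t := 0) (by rw [hV0]; exact horth)]
      exact (hV.smooth.differentiable (by simp)).differentiableAt.hasDerivAt
    have hB' : HasDerivAt B (deriv B 0) 0 :=
      (hB.smooth.differentiable (by simp)).differentiableAt.hasDerivAt
    have hm : HasDerivAt (fun t : ℝ => α * t) α 0 := by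
      simpa using (hasDerivAt_id (0 : ℝ)).const_mul α
    have hd := hasDerivAt_wedge (γ.hasDerivAt 0)
      ((hm.cos.smul hV').add (hm.sin.smul hB'))
    have hd' := hd.congr_deriv (g' := scalarMul (⟨α, 1⟩ : Scalar κ)
      (wedge (σ.curve 0) (cross κ (σ.curve 0) (deriv γ.curve 0) (deriv σ.curve 0)))) (by
        rw [scalarMul, ← wedge_eq_mulOmega hp hA hAu.right_mem, ← eq_cross_of_isCross hp hAu hB0]
        simp only [Pi.add_apply, Pi.smul_apply', mul_zero, Real.cos_zero, Real.sin_zero, hγ, hV0]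
        ext i
        fin_cases i <;> simp [wedge] <;> ring)
    exact hd'.congr_of_eventuallyEq (Eventually.of_forall hpl)

/-- A tangent vector orthogonal to a geodesic, regarded as a constant vector of `ℝ⁴`, is a parallel
field along it. -/
lemma isParallelAlong_const {p A u : Fin 4 → ℝ} (hp : p ∈ spaceForm κ)
    (h : IsOrthonormalPair κ p A u) {γ : UnitGeodesic κ} (h0 : γ.curve 0 = p)
    (h1 : deriv γ.curve 0 = A) : IsParallelAlong κ γ.curve fun _ => u where
  smooth := contDiff_const
  tangent t := by
    have e := dualForm_of_tangent hp h.left_mem (y := u)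
    have hu := h.right_mem
    rw [h.orthogonal] at e
    rw [(γ.formula t).1, h0, h1]
    simp only [tangentPlane, mem_ofPred_eq, dualForm, Pi.add_apply, Pi.smul_apply,
      smul_eq_mul] at *
    linear_combination cosK κ t * hu + sinK κ t * e
  parallel t w _ := by simp [form]

lemma exists_isHelicoidalCurve (α : ℝ) {p A u : Fin 4 → ℝ} (hp : p ∈ spaceForm κ)
    (h : IsOrthonormalPair κ p A u) : ∃ l Γ, IsHelicoidalCurve κ α l p A Γ ∧
      plucker l = wedge p u := by
  obtain ⟨σ0, σ1⟩ := geodesicOf_zero hp h.right_mem h.right_unit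
  obtain ⟨γ0, γ1⟩ := geodesicOf_zero hp h.left_mem h.left_unit
  set σ := geodesicOf hp h.right_mem h.right_unit
  set γ := geodesicOf hp h.left_mem h.left_unit
  have hB := isCross_cross hp h
  set B := cross κ p A u
  have hAB : IsOrthonormalPair κ p A B := ⟨h.left_mem, hB.1, h.left_unit, hB.2.1, hB.2.2.1⟩
  have pu := isParallelAlong_const hp h γ0 γ1
  have pB := isParallelAlong_const hp hAB γ0 γ1
  have ht : ∀ t, Real.cos (α * t) • u + Real.sin (α * t) • B ∈ tangentPlane κ (γ.curve t) := by
    intro t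
    have e1 := pu.tangent t
    have e2 := pB.tangent t
    simp only [tangentPlane, mem_ofPred_eq, dualForm, Pi.add_apply, Pi.smul_apply,
      smul_eq_mul] at *
    linear_combination Real.cos (α * t) * e1 + Real.sin (α * t) * e2
  have hu : ∀ t, form κ (Real.cos (α * t) • u + Real.sin (α * t) • B)
      (Real.cos (α * t) • u + Real.sin (α * t) • B) = 1 := by
    intro t
    have e1 := h.right_unit
    have e2 := hB.2.1
    have e3 := hB.2.2.2.1
    have e4 := Real.cos_sq_add_sin_sq (α * t)
    simp only [form, Pi.add_apply, Pi.smul_apply, smul_eq_mul] at *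
    linear_combination Real.cos (α * t) ^ 2 * e1 + Real.sin (α * t) ^ 2 * e2
      + 2 * Real.cos (α * t) * Real.sin (α * t) * e3 + e4
  refine ⟨Quotient.mk _ σ, fun t => Quotient.mk _ (geodesicOf (γ.mem t) (ht t) (hu t)),
    ⟨σ, γ, fun _ => u, fun _ => B, rfl, σ0, γ0, γ1, ?_, pu, σ1.symm, pB, ?_, fun t =>
      ⟨_, rfl, geodesicOf_zero (γ.mem t) (ht t) (hu t)⟩⟩, ?_⟩
  · rw [σ1]; exact h.orthogonal
  · rw [σ1]; exact hB
  · change wedge _ _ = _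
    rw [σ0, σ1]

lemma eq_of_wedge_eq {p x y : Fin 4 → ℝ} (hp : p ∈ spaceForm κ) (hx : x ∈ tangentPlane κ p)
    (hy : y ∈ tangentPlane κ p) (h : wedge p x = wedge p y) : x = y := by
  have hxy : x - y ∈ tangentPlane κ p := by
    simp only [tangentPlane, mem_ofPred_eq, dualForm, Pi.sub_apply] at *
    linear_combination hx - hy
  have e1 := (dual_dotProduct _ _ _).1 (dual_wedge_dotProduct hp hxy hxy)
  have e2 : wedge p (x - y) = wedge p x - wedge p y := by
    ext i; fin_cases i <;> simp [wedge] <;> ring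
  rw [e2, h, sub_self] at e1
  simp only [Pi.zero_apply, mul_zero, add_zero] at e1
  exact sub_eq_zero.1 (eq_zero_of_form_self hp hxy e1.1.symm)

lemma exists_of_mem_admissible {v : TangentBundle (𝓡 4) (OrientedGeodesic κ)}
    (hv : v ∈ admissible κ α) : ∃ z ∈ dualPairs κ,
      tangentPlucker v = (z.1, scalarMul (⟨α, 1⟩ : Scalar κ) z.2) := by
  obtain ⟨l, p, A, Γ, hΓ, hd, rfl⟩ := hv
  obtain ⟨u, hp, h, -, h0, h1⟩ := hΓ.exists_hasDerivAt
  have hB := isCross_cross hp h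
  refine ⟨(wedge p u, wedge p (cross κ p A u)), wedge_mem_dualPairs hp
    ⟨h.right_mem, hB.1, h.right_unit, hB.2.1, hB.2.2.2.1⟩, ?_⟩
  rw [tangentPlucker_velocity hd h1, h0]

lemma exists_mem_admissible (α : ℝ) {z : (Fin 6 → ℝ) × (Fin 6 → ℝ)} (hz : z ∈ dualPairs κ) :
    ∃ v ∈ admissible κ α, tangentPlucker v = (z.1, scalarMul (⟨α, 1⟩ : Scalar κ) z.2) := by
  obtain ⟨p, u, b, hp, h, h1, h2⟩ := exists_frame_of_mem_dualPairs hz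
  -- the axis has the direction `u × b`, so that `b = (u × b) × u`
  have hA := isCross_cross hp h
  have hAu : IsOrthonormalPair κ p (cross κ p u b) u :=
    ⟨hA.1, h.left_mem, hA.2.1, h.left_unit, by rw [form_comm]; exact hA.2.2.1⟩
  obtain ⟨l, Γ, hΓ, hl⟩ := exists_isHelicoidalCurve α hp hAu
  obtain ⟨u', -, hAu', hl', h0, hd⟩ := hΓ.exists_hasDerivAt
  obtain rfl := eq_of_wedge_eq hp hAu'.right_mem h.left_mem (hl'.symm.trans hl)
  rw [← eq_cross_of_isCross hp hAu (isCross_rotate hp h)] at hd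
  have hm := mdifferentiableAt_of_plucker hd.differentiableAt
  refine ⟨_, ⟨l, p, _, Γ, hΓ, hm, rfl⟩, ?_⟩
  rw [tangentPlucker_velocity hm hd, h0, h1, h2]

/-! ### The space of admissible vectors and its fibers -/

lemma scalar_inverse_mul (h : α ^ 2 ≠ (κ : ℝ)) :
    (⟨α / (α ^ 2 - κ), -1 / (α ^ 2 - κ)⟩ : Scalar κ) * ⟨α, 1⟩ = 1 := by
  have h0 : α ^ 2 - κ ≠ 0 := sub_ne_zero.2 h
  ext
  · simp [QuadraticAlgebra.re_one]
    field_simp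
    ring
  · simp [QuadraticAlgebra.im_one]
    field_simp
    ring

/-- Multiplication of bivectors by an invertible element of `ℝ[ω]`. -/
def scalarMulHomeomorph {r s : Scalar κ} (h : s * r = 1) : (Fin 6 → ℝ) ≃ₜ (Fin 6 → ℝ) where
  toFun := scalarMul r
  invFun := scalarMul s
  left_inv w := by rw [scalarMul_scalarMul, h, scalarMul_one]
  right_inv w := by rw [scalarMul_scalarMul, mul_comm, h, scalarMul_one]
  continuous_toFun := continuous_scalarMul r
  continuous_invFun := continuous_scalarMul s

/-- The initial velocities of the helicoidal curves form a copy of `SO(3, ℝ[ω])`, if `α + ω` is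
invertible. -/
lemma exists_homeomorph_dualPairs (h : α ^ 2 ≠ (κ : ℝ)) :
    ∃ e : admissible κ α ≃ₜ dualPairs κ, ∀ v, plucker v.1.proj = (e v).1.1 := by
  let H := (Homeomorph.refl (Fin 6 → ℝ)).prodCongr (scalarMulHomeomorph (scalar_inverse_mul h))
  have hmem : ∀ v : admissible κ α, H.symm (tangentPlucker v.1) ∈ dualPairs κ := by
    rintro ⟨v, hv⟩
    obtain ⟨z, hz, hvz⟩ := exists_of_mem_admissible hv
    have : tangentPlucker v = H z := hvz
    rwa [this, H.symm_apply_apply]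
  have hemb : IsEmbedding (Set.codRestrict _ _ hmem) :=
    (H.symm.isEmbedding.comp (isEmbedding_tangentPlucker.comp .subtypeVal)).codRestrict _ _
  have hsurj : Function.Surjective (Set.codRestrict _ _ hmem) := by
    rintro ⟨z, hz⟩
    obtain ⟨v, hv, hvz⟩ := exists_mem_admissible α hz
    refine ⟨⟨v, hv⟩, Subtype.ext ?_⟩
    have : tangentPlucker v = H z := hvz
    change H.symm (tangentPlucker v) = z
    rw [this, H.symm_apply_apply]
  exact ⟨hemb.toHomeomorphOfSurjective hsurj, fun v => rfl⟩

lemma hasContinuousLogs_admissible (h : α ^ 2 ≠ (κ : ℝ)) :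
    HasContinuousLogs (admissible κ α) := by
  obtain ⟨e, -⟩ := exists_homeomorph_dualPairs h
  exact (hasContinuousLogs_dualPairs κ).of_retract e.symm.continuous e.continuous
    e.symm_apply_apply

/-- The sum of the two coordinates of an element of `ℝ[ω]` does not vanish for both of `X` and `Y`
if `X² + Y² = 1`. -/
lemma sum_ne_zero_of_sq_add_sq {X Y : Scalar κ} (h : X * X + Y * Y = 1) :
    X.re + X.im ≠ 0 ∨ Y.re + Y.im ≠ 0 := by
  by_contra! hc
  obtain ⟨hX, hY⟩ := hc
  have h1 := congrArg QuadraticAlgebra.re h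
  have h2 := congrArg QuadraticAlgebra.im h
  simp [QuadraticAlgebra.re_one, QuadraticAlgebra.im_one] at h1 h2
  rw [eq_neg_of_add_eq_zero_right hX, eq_neg_of_add_eq_zero_right hY] at h1 h2
  have hx : X.re = 0 := by nlinarith [sq_nonneg X.re, sq_nonneg Y.re]
  have hy : Y.re = 0 := by nlinarith [sq_nonneg X.re, sq_nonneg Y.re]
  simp [hx, hy] at h1

/-- The real function of a bivector `y` given by the sum of the two coordinates of the element
`⟨x, y⟩` of `ℝ[ω]`. -/
def coordSum (κ : SignType) (x y : Fin 6 → ℝ) : ℝ :=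
  (dual κ x ⬝ᵥ dual κ y).re + (dual κ x ⬝ᵥ dual κ y).im

lemma continuous_coordSum (x : Fin 6 → ℝ) : Continuous (coordSum κ x) := by
  have h := fun y => (dual_dotProduct (κ := κ) x y _).1 rfl
  have : coordSum κ x = fun y =>
      x 0 * y 0 + x 1 * y 1 + x 2 * y 2 + κ * (x 3 * y 3 + x 4 * y 4 + x 5 * y 5)
        + (x 0 * y 3 + x 1 * y 4 + x 2 * y 5 + (x 3 * y 0 + x 4 * y 1 + x 5 * y 2)) :=
    funext fun y => by rw [coordSum, ← (h y).1, ← (h y).2]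
  rw [this]
  fun_prop

/-- The fiber of `𝒜_κ^α` contains a loop on which a function without zeros on the fiber has
winding number one: in the fiber of `SO(3, ℝ[ω]) → 𝒢_κ`, which is the unit circle
`{X y₀ + Y y₁ | X² + Y² = 1}` over `ℝ[ω]`, the loop is the real unit circle. -/
lemma not_hasContinuousLogs_prod_fiber (h : α ^ 2 ≠ (κ : ℝ)) (l : OrientedGeodesic κ) :
    ¬ HasContinuousLogs (OrientedGeodesic κ × admissibleFiber κ α l) := by
  obtain ⟨e, he⟩ := exists_homeomorph_dualPairs h
  obtain ⟨p, u, hp, hu, huu, hl⟩ := exists_of_mem_quadric (plucker_mem l)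
  obtain ⟨b, hb⟩ := exists_isOrthonormalPair hp hu huu
  have hc := isCross_cross hp hb
  have h0 := wedge_mem_dualPairs hp hb
  have h1 := wedge_mem_dualPairs hp
    (⟨hu, hc.1, huu, hc.2.1, hc.2.2.1⟩ : IsOrthonormalPair κ p u (cross κ p u b))
  have h01 := (wedge_mem_dualPairs hp
    (⟨hb.right_mem, hc.1, hb.right_unit, hc.2.1, hc.2.2.2.1⟩ :
      IsOrthonormalPair κ p b (cross κ p u b))).2.2
  obtain ⟨hww, h00, hw0⟩ := h0
  obtain ⟨-, h11, hw1⟩ := h1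
  simp only at hww h00 hw0 h11 hw1 h01
  have hexp := eq_sum_dual_wedge hp hb
  rw [hl] at hww hw0 hw1 hexp
  set y₀ := wedge p b
  set y₁ := wedge p (cross κ p u b)
  have h10 : dual κ y₁ ⬝ᵥ dual κ y₀ = 0 := by rw [dotProduct_comm]; exact h01
  let y : ℝ → Fin 6 → ℝ := fun θ =>
    scalarMul (⟨Real.cos θ, 0⟩ : Scalar κ) y₀ + scalarMul (⟨Real.sin θ, 0⟩ : Scalar κ) y₁
  have hy : ∀ θ, dual κ (y θ) = (⟨Real.cos θ, 0⟩ : Scalar κ) • dual κ y₀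
      + (⟨Real.sin θ, 0⟩ : Scalar κ) • dual κ y₁ := fun θ => by
    rw [dual_add, dual_scalarMul, dual_scalarMul]
  have hycont : Continuous y := by
    simp only [y, scalarMul]
    fun_prop
  have hy0 : ∀ θ, dual κ y₀ ⬝ᵥ dual κ (y θ) = ⟨Real.cos θ, 0⟩ := fun θ => by
    rw [hy, dotProduct_add, dotProduct_smul, dotProduct_smul, h00, h01, smul_zero, add_zero,
      smul_eq_mul, mul_one]
  have hy1 : ∀ θ, dual κ y₁ ⬝ᵥ dual κ (y θ) = ⟨Real.sin θ, 0⟩ := fun θ => by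
    rw [hy, dotProduct_add, dotProduct_smul, dotProduct_smul, h10, h11, smul_zero, zero_add,
      smul_eq_mul, mul_one]
  have hmem : ∀ θ, (plucker l, y θ) ∈ dualPairs κ := by
    refine fun θ => ⟨hww, ?_, ?_⟩
    · change dual κ (y θ) ⬝ᵥ dual κ (y θ) = 1
      nth_rewrite 1 [hy]
      rw [add_dotProduct, smul_dotProduct, smul_dotProduct, hy0, hy1, smul_eq_mul, smul_eq_mul]
      ext
      · simp [QuadraticAlgebra.re_one]
        linear_combination Real.cos_sq_add_sin_sq θ
      · simp [QuadraticAlgebra.im_one]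
    · change dual κ (plucker l) ⬝ᵥ dual κ (y θ) = 0
      rw [hy, dotProduct_add, dotProduct_smul, dotProduct_smul, hw0, hw1, smul_zero, smul_zero,
        add_zero]
  let c : ℝ → OrientedGeodesic κ × admissibleFiber κ α l := fun θ =>
    (l, ⟨e.symm ⟨_, hmem θ⟩, plucker_injective (by
      rw [admissibleProj, he, e.apply_symm_apply])⟩)
  let f : OrientedGeodesic κ × admissibleFiber κ α l → ℂ := fun x =>
    (coordSum κ y₀ (e x.2.1).1.2 : ℂ) + coordSum κ y₁ (e x.2.1).1.2 * Complex.I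
  have hzcont : Continuous fun x : OrientedGeodesic κ × admissibleFiber κ α l =>
      (e x.2.1).1.2 := by
    fun_prop
  have hf : Continuous f :=
    (Complex.continuous_ofReal.comp ((continuous_coordSum y₀).comp hzcont)).add
      ((Complex.continuous_ofReal.comp ((continuous_coordSum y₁).comp hzcont)).mul
        continuous_const)
  refine HasContinuousLogs.not_of_loop hf ?_ (c := c) ?_ ?_ ?_
  · rintro ⟨m, v, hv⟩ hx
    have hre := congrArg Complex.re hx
    have him := congrArg Complex.im hx
    simp [f] at hre him
    have hw : (e v).1.1 = plucker l := by rw [← he]; exact congrArg plucker hv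
    obtain ⟨-, hzz, hwz⟩ := (e v).2
    rw [hw] at hwz
    have hz := hexp (dual κ (e v).1.2)
    rw [hwz, zero_smul, zero_add] at hz
    have hXY := hzz
    nth_rewrite 1 [hz] at hXY
    rw [add_dotProduct, smul_dotProduct, smul_dotProduct, smul_eq_mul, smul_eq_mul] at hXY
    rcases sum_ne_zero_of_sq_add_sq hXY with h | h
    · exact h hre
    · exact h him
  · refine continuous_const.prodMk (Continuous.subtype_mk (e.symm.continuous.comp ?_) _)
    exact (continuous_const.prodMk hycont).subtype_mk _
  · have : y (2 * Real.pi) = y 0 := by simp [y]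
    simp only [c, this]
  · intro θ
    simp only [f, c, e.apply_symm_apply, coordSum, hy0, hy1, add_zero, Complex.exp_mul_I,
      Complex.ofReal_cos, Complex.ofReal_sin]

/-- The fiber of a trivial bundle over `b`. -/
def trivialFiberHomeomorph {B F Z : Type*} [TopologicalSpace B] [TopologicalSpace F]
    [TopologicalSpace Z] {proj : Z → B} (e : Z ≃ₜ B × F) (he : ∀ x, (e x).1 = proj x) (b : B) :
    {x // proj x = b} ≃ₜ F where
  toFun x := (e x.1).2
  invFun y := ⟨e.symm (b, y), by rw [← he, e.apply_symm_apply]⟩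
  left_inv := by
    rintro ⟨x, rfl⟩
    apply Subtype.ext
    simp only [← he, Prod.mk.eta, e.symm_apply_apply]
  right_inv y := by simp
  continuous_toFun := by fun_prop
  continuous_invFun := by fun_prop

end Helicoid

theorem mainTheorem2 (κ : SignType) (α : ℝ) (h : α ^ 2 ≠ (κ : ℝ)) :
    (∀ (F : Type*) [TopologicalSpace F],
      ¬ IsHomeomorphicTrivialFiberBundle F (Helicoid.admissibleProj κ α)) ∧
    ∀ l : Helicoid.OrientedGeodesic κ,
      IsEmpty (Helicoid.admissible κ α ≃ₜ
        Helicoid.OrientedGeodesic κ × Helicoid.admissibleFiber κ α l) := by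
  have key : ∀ l : Helicoid.OrientedGeodesic κ,
      IsEmpty (Helicoid.admissible κ α ≃ₜ
        Helicoid.OrientedGeodesic κ × Helicoid.admissibleFiber κ α l) := fun l =>
    ⟨fun e => Helicoid.not_hasContinuousLogs_prod_fiber h l
      ((Helicoid.hasContinuousLogs_admissible h).of_retract e.continuous e.symm.continuous
        e.apply_symm_apply)⟩
  refine ⟨fun F _ ⟨e, he⟩ => ?_, key⟩
  -- any geodesic serves as the base point
  let l := Helicoid.OrientedGeodesic.ofPlucker κ 0
  exact (key l).false (e.trans ((Homeomorph.refl _).prodCongr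
    (Helicoid.trivialFiberHomeomorph e he l).symm))
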